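/- A permutation of size $n\ge 0$ is a bijection of $\{1,\dots,n\}$, viewed as the point set $\{(i,\pi(i))\}$. A permutation $\sigma$ is the pattern of a set of elements of $\pi$ if there is a bijection between this set and the elements of $\sigma$ that preserves both the order of positions and the order of values; $\sigma$ is a subpermutation of $\pi$, written $\sigma\le\pi$, if it is the pattern of some set of elements of $\pi$. A permutation class is a set of permutations closed downwards under $\le$, and $\mathrm{Av}(\sigma)$ is the class of all permutations $\rho$ with $\sigma\not\le\rho$. The sum $\alpha\oplus\beta$ (skew sum $\alpha\ominus\beta$) is obtained by placing a copy of $\beta$ above (below) and to the right of a copy of $\alpha$. A permutation is sum-decomposable (skew-decomposable) if it is a sum (skew sum) of two non-empty permutations, and otherwise sum-indecomposable (skew-indecomposable). The separable permutations form the smallest set of permutations that contains the empty permutation and the singleton permutation $1$ and is closed under $\oplus$ and $\ominus$. The decomposition tree $T(\pi)$ of a non-empty separable permutation $\pi$ is defined recursively: $T(1)$ is a single leaf; if $\pi=\pi_1\oplus\dots\oplus\pi_k$ with $k\ge2$ and non-empty sum-indecomposable $\pi_i$, then the root of $T(\pi)$ is a $\oplus$-node with the $k$ child subtrees $T(\pi_1),\dots,T(\pi_k)$;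 for skew-decomposable $\pi$ one proceeds analogously with $\ominus$. A slim permutation is a separable permutation in whose decomposition tree every internal node has exactly two children, at least one of which is a leaf. The merge $\mathcal C_1\odot\dots\odot\mathcal C_k$ of classes consists of all permutations whose elements can be partitioned into $k$ (possibly empty) sets such that the pattern of the $i$-th set belongs to $\mathcal C_i$ for each $i$. A class $\mathcal C$ is splittable over a set $X$ of classes if there is a finite sequence $\mathcal C_1,\dots,\mathcal C_k$ of members of $X$ (repetitions allowed) with $\mathcal C\subseteq\mathcal C_1\odot\dots\odot\mathcal C_k$. **Lemma.** Let $\pi$ be a separable sum-decomposable permutation. Then the class $\mathrm{Av}(\pi)$ is splittable over the set of classes $$\{\mathrm{Av}(\sigma) : \sigma\le\pi,\ \sigma \text{ slim and sum-decomposable}\}.$$ -/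

import Mathlib

/-- A (finite) permutation: a size `n ≥ 0` and a bijection of an `n`-element chain
(`Fin n`, i.e. positions and values are counted from `0`). -/
structure FinPerm where
  size : ℕ
  perm : Equiv.Perm (Fin size)

namespace FinPerm

/-- The empty permutation. -/
def empty : FinPerm := ⟨0, 1⟩

/-- The singleton permutation `1`. -/
def one : FinPerm := ⟨1, 1⟩

/-- `σ` is the pattern of the set `S` of elements of `π` (given by their positions): the
increasing enumeration `f` of `S` carries the order of the values of `σ` to the one of `π`. -/
def IsPatternOf (σ π : FinPerm) (S : Set (Fin π.size)) : Prop :=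
  ∃ f : Fin σ.size ↪o Fin π.size, Set.range f = S ∧
    ∀ i j, σ.perm i < σ.perm j ↔ π.perm (f i) < π.perm (f j)

/-- `σ ≤ π`: `σ` is contained in `π`, i.e. `σ` is the pattern of some set of elements of `π`. -/
instance : Preorder FinPerm where
  le σ π := ∃ S, IsPatternOf σ π S
  le_refl π := ⟨_, RelEmbedding.refl _, rfl, fun _ _ => Iff.rfl⟩
  le_trans := by
    rintro ρ σ π ⟨_, f, -, hf⟩ ⟨_, g, -, hg⟩
    exact ⟨_, f.trans g, rfl, fun i j => (hf i j).trans (hg _ _)⟩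

/-- The sum `π ⊕ σ`: a copy of `σ` above and to the right of a copy of `π`. -/
def sum (π σ : FinPerm) : FinPerm where
  size := π.size + σ.size
  perm := finSumFinEquiv.symm.trans ((Equiv.sumCongr π.perm σ.perm).trans finSumFinEquiv)

/-- The skew sum `π ⊖ σ`: a copy of `σ` below and to the right of a copy of `π`. -/
def skewSum (π σ : FinPerm) : FinPerm where
  size := π.size + σ.size
  perm := finSumFinEquiv.symm.trans ((Equiv.sumCongr π.perm σ.perm).trans
    ((Equiv.sumComm _ _).trans (finSumFinEquiv.trans (finCongr (Nat.add_comm _ _)))))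

/-- `π` is the sum of two non-empty permutations. -/
def IsSumDecomposable (π : FinPerm) : Prop :=
  ∃ α β : FinPerm, 0 < α.size ∧ 0 < β.size ∧ π = α.sum β

/-- `π` is the skew sum of two non-empty permutations. -/
def IsSkewDecomposable (π : FinPerm) : Prop :=
  ∃ α β : FinPerm, 0 < α.size ∧ 0 < β.size ∧ π = α.skewSum β

/-- The iterated sum `π₁ ⊕ π₂ ⊕ ⋯ ⊕ πₖ` of a list of permutations. -/
def listSum (l : List FinPerm) : FinPerm := l.foldr sum empty

/-- The iterated skew sum `π₁ ⊖ π₂ ⊖ ⋯ ⊖ πₖ` of a list of permutations. -/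
def listSkewSum (l : List FinPerm) : FinPerm := l.foldr skewSum empty

/-- The separable permutations: the smallest set of permutations that contains the empty
permutation and the singleton and is closed under sums and skew sums. -/
inductive IsSeparable : FinPerm → Prop
  | empty : IsSeparable empty
  | one : IsSeparable one
  | sum {σ τ : FinPerm} : IsSeparable σ → IsSeparable τ → IsSeparable (σ.sum τ)
  | skewSum {σ τ : FinPerm} : IsSeparable σ → IsSeparable τ → IsSeparable (σ.skewSum τ)

end FinPerm

/-- Rooted ordered trees whose internal nodes are `⊕`-nodes and `⊖`-nodes; a node with children
`c 0, …, c (k - 1)` is given by `k` and `c`. -/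
inductive DecompTree : Type
  | leaf : DecompTree
  | plusNode (k : ℕ) (c : Fin k → DecompTree) : DecompTree
  | minusNode (k : ℕ) (c : Fin k → DecompTree) : DecompTree

namespace DecompTree

/-- Each internal node has exactly two children, and at least one of them is a leaf. -/
def IsSlim : DecompTree → Prop
  | leaf => True
  | plusNode k c => k = 2 ∧ (∃ i, c i = leaf) ∧ ∀ i, (c i).IsSlim
  | minusNode k c => k = 2 ∧ (∃ i, c i = leaf) ∧ ∀ i, (c i).IsSlim

/-- `T.Represents π`: `T` is the decomposition tree of `π`. The singleton has the one-leaf tree;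
`π = π₁ ⊕ ⋯ ⊕ πₖ` with `k ≥ 2` and (non-empty) sum-indecomposable `πᵢ` has a `⊕`-node as root,
with the decomposition trees of `π₁, …, πₖ` below it in this order; similarly for `⊖`.
(No tree represents the empty permutation, so the `πᵢ` are automatically non-empty.) -/
inductive Represents : DecompTree → FinPerm → Prop
  | leaf : Represents leaf FinPerm.one
  | plusNode {k : ℕ} (hk : 2 ≤ k) (c : Fin k → DecompTree) (p : Fin k → FinPerm)
      (hp : ∀ i, ¬ (p i).IsSumDecomposable) (hc : ∀ i, Represents (c i) (p i)) :
      Represents (plusNode k c) (FinPerm.listSum (List.ofFn p))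
  | minusNode {k : ℕ} (hk : 2 ≤ k) (c : Fin k → DecompTree) (p : Fin k → FinPerm)
      (hp : ∀ i, ¬ (p i).IsSkewDecomposable) (hc : ∀ i, Represents (c i) (p i)) :
      Represents (minusNode k c) (FinPerm.listSkewSum (List.ofFn p))

end DecompTree

/-- A slim permutation: a separable permutation whose decomposition tree is slim. -/
def FinPerm.IsSlim (π : FinPerm) : Prop :=
  π.IsSeparable ∧ ∃ T : DecompTree, T.Represents π ∧ T.IsSlim

/-- A permutation class: a set of permutations closed downwards under containment. -/
abbrev PermClass := LowerSet FinPerm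

namespace PermClass

/-- `Av(F)`, the class of the permutations that contain no member of `F`. -/
def Av (F : Set FinPerm) : PermClass where
  carrier := {π | ∀ σ ∈ F, ¬ σ ≤ π}
  lower' := fun _ _ hle h σ hσ hσρ => h σ hσ (hσρ.trans hle)

/-- The set `σ ⊙ τ` of the merges of `σ` and `τ`: the permutations whose elements can be
partitioned into a set with pattern `σ` and a set with pattern `τ`. -/
def permMerge (σ τ : FinPerm) : Set FinPerm :=
  {π | ∃ S : Set (Fin π.size), σ.IsPatternOf π S ∧ τ.IsPatternOf π Sᶜ}

/-- The merge `C ⊙ D` of two sets of permutations: all merges of a member of `C` with a member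
of `D`. -/
def merge (C D : Set FinPerm) : Set FinPerm := {π | ∃ σ ∈ C, ∃ τ ∈ D, π ∈ permMerge σ τ}

/-- The iterated merge `C₁ ⊙ C₂ ⊙ ⋯ ⊙ Cₖ` of a finite sequence of classes; the innermost factor
`{empty}` is neutral for `⊙`. -/
def mergeSeq : List PermClass → Set FinPerm
  | [] => {FinPerm.empty}
  | C :: L => merge (C : Set FinPerm) (mergeSeq L)

/-- `C` is `X`-splittable: there is a finite sequence `C₁, …, Cₖ` (repetitions allowed) of
classes belonging to `X` with `C ⊆ C₁ ⊙ ⋯ ⊙ Cₖ`. -/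
def IsSplittableOver (C : PermClass) (X : Set PermClass) : Prop :=
  ∃ L : List PermClass, (∀ D ∈ L, D ∈ X) ∧ (C : Set FinPerm) ⊆ mergeSeq L

end PermClass

/-!
A non-empty separable permutation is described by a binary term (`SepTree`) built from singletons
by sums and skew sums, and containment of such a pattern in a point set is defined by recursion on
the term. By induction on the number of leaves, the class of the permutations that avoid a sum is
splittable over the classes of the permutations that avoid a slim sum-decomposable pattern of it
(`SepTree.splits_node`). Complements and reverse complements leave three reductions to smaller
terms.

* `Av(a ⊕ b) ⊆ Av(a ⊕ 1) ⊙ Av(1 ⊕ b)`, used if neither `a` nor `b` is a singleton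
  (`SepTree.splitsOver_two`).
* `Av(a ⊕ b ⊕ 1) ⊆ Av(a ⊕ b) ⊙ Av(b ⊕ 1)`, by a greedy colouring from left to right
  (`SepTree.splitsOver_three`).
* If `a` is a skew sum, then by induction `Av(a)` is splittable over classes `Av(σ)` with slim
  skew-decomposable `σ`; then `Av(a ⊕ 1)` is splittable over the classes `Av(σ ⊕ 1)`, and `σ ⊕ 1`
  is slim (`SepTree.Splits.node_leaf`).

The last reduction is the main point, and it generalizes the theorem of Gyárfás that the chromatic
number of circle graphs is bounded in terms of the clique number. Elements that are not
right-to-left maxima are turned into intervals in such a way that a set of elements has a common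
element above and to the right of it if and only if its intervals have a common point, and in such
a set inversions correspond to crossing intervals. In particular a copy of a skew-decomposable
`σ` is connected in the overlap graph, so that components of this graph can be coloured separately.

To colour a family that has no copy of `a`, of size `n`, with a common point, each component of the
overlap graph is cut into layers according to the distance from its first interval. In a connected
piece `H` of a layer each interval is crossed by one of the previous layer that extends beyond the
span of `H` on the other side (`IntervalFamily.Good.of_dominated`); separating the layers by parity
and the intervals by the side of the crossing, one passes to such pieces, and repeats this `2 * n`
times. Then one side, say the left, was chosen `n` times. If `H` still has `n` pairwise disjoint
intervals, then for each of the `n` rounds one of them can be selected freely, and there is an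
interval of this round that ends in the selected one; all these intervals contain the left end of
`H` and start in the order of the rounds. As the order of their right ends is arbitrary, they can be
made to form a copy of `a` (`IntervalFamily.LeftRich.exists_copy`). So there are fewer than `n`
pairwise disjoint intervals in `H`, hence `H` is a union of at most `n` families with a common
point, to which the splitting of `Av(a)` applies.
-/

/-! ### Families of intervals -/

/-- A family of intervals `[L y, R y]` in a linear order, no two of which share an end. -/
structure IntervalFamily (Y Λ : Type) [LinearOrder Λ] where
  L : Y → Λ
  R : Y → Λ
  L_inj : Function.Injective L
  R_inj : Function.Injective R
  L_lt_R : ∀ y, L y < R y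
  L_ne_R : ∀ x y, L x ≠ R y

namespace IntervalFamily

variable {Y Λ ι : Type} [LinearOrder Λ] (I : IntervalFamily Y Λ)

/-- The intervals of `x` and `y` overlap, neither contains the other, and `x` is on the left. -/
def Crosses (x y : Y) : Prop := I.L x < I.L y ∧ I.L y < I.R x ∧ I.R x < I.R y

/-- The overlap graph: two intervals are adjacent if they meet and neither contains the other. -/
def Overlap (x y : Y) : Prop := I.Crosses x y ∨ I.Crosses y x

/-- Any two intervals of `A` meet; for a finite `A` this says that the intervals have a point in
common. -/
def Stabbed (A : Set Y) : Prop := ∀ x ∈ A, ∀ y ∈ A, I.L x < I.R y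

/-- The overlap graph, with all edges that leave `A` deleted. -/
def overlapGraph (A : Set Y) : SimpleGraph Y where
  Adj x y := x ∈ A ∧ y ∈ A ∧ I.Overlap x y
  symm := ⟨fun _ _ h => ⟨h.2.1, h.1, h.2.2.symm⟩⟩
  loopless := ⟨fun _ h => by
    rcases h.2.2 with h | h <;> exact lt_irrefl _ h.1⟩

/-- `B` is non-empty and connected in the overlap graph, expressed through functions that are
constant along edges. -/
def Connected (B : Set Y) : Prop :=
  B.Nonempty ∧ ∀ (κ : Type) (g : Y → κ),
    (∀ x ∈ B, ∀ y ∈ B, I.Overlap x y → g x = g y) → ∀ x ∈ B, ∀ y ∈ B, g x = g y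

/-- `A` can be coloured by `N` palettes of colours indexed by `ι` in such a way that the colour
classes with index `i` include no set of the family `pat i`. -/
def Good (pat : ι → Set Y → Prop) (N : ℕ) (A : Set Y) : Prop :=
  ∃ col : Y → ℕ × ι, (∀ y ∈ A, (col y).1 < N) ∧
    ∀ c, ∀ B ⊆ A, (∀ y ∈ B, col y = c) → ¬ pat c.2 B

variable {I} {pat : ι → Set Y → Prop}

theorem Good.mono {M N : ℕ} {A B : Set Y} (h : Good pat N B) (hN : N ≤ M) (hA : A ⊆ B) :
    Good pat M A := by
  obtain ⟨col, h1, h2⟩ := h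
  exact ⟨col, fun y hy => (h1 y (hA hy)).trans_le hN, fun c D hD => h2 c D (hD.trans hA)⟩

theorem Good.union {M N : ℕ} {A B : Set Y} (hA : Good pat M A) (hB : Good pat N B) :
    Good pat (M + N) (A ∪ B) := by
  classical
  obtain ⟨f, f1, f2⟩ := hA
  obtain ⟨g, g1, g2⟩ := hB
  refine ⟨fun y => if y ∈ A then f y else (M + (g y).1, (g y).2), ?_, ?_⟩
  · intro y hy
    by_cases h : y ∈ A
    · simp only [h, if_true]; have := f1 y h; omega
    · simp only [h, if_false]; have := g1 y (hy.resolve_left h); omega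
  · intro c D hD hc
    by_cases hcM : c.1 < M
    · have hDA : ∀ y ∈ D, y ∈ A := by
        intro y hy
        by_contra h
        have := hc y hy
        simp only [h, if_false] at this
        rw [← this] at hcM
        simp at hcM
      refine f2 c D hDA fun y hy => ?_
      have := hc y hy
      simpa only [hDA y hy, if_true] using this
    · have hDA : ∀ y ∈ D, y ∉ A := by
        intro y hy h
        have := hc y hy
        simp only [h, if_true] at this
        exact hcM (this ▸ f1 y h)
      refine g2 (c.1 - M, c.2) D (fun y hy => (hD hy).resolve_left (hDA y hy)) fun y hy => ?_
      have := hc y hy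
      simp only [hDA y hy, if_false] at this
      rw [← this]
      simp

/-- Since the forbidden sets are connected, the connected components of the overlap graph may be
coloured independently of each other. -/
theorem Good.of_components (hconn : ∀ i B, pat i B → I.Connected B) {N : ℕ} {A : Set Y}
    {κ : Type} (g : Y → κ) (hg : ∀ x ∈ A, ∀ y ∈ A, I.Overlap x y → g x = g y)
    (h : ∀ k, Good pat N {y ∈ A | g y = k}) : Good pat N A := by
  choose col h1 h2 using h
  refine ⟨fun y => col (g y) y, fun y hy => h1 _ y ⟨hy, rfl⟩, fun c B hB hc hp => ?_⟩
  obtain ⟨⟨y, hy⟩, hcon⟩ := hconn _ _ hp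
  have hk := hcon κ g fun x hx z hz => hg x (hB hx) z (hB hz)
  refine h2 (g y) c B (fun x hx => ⟨hB hx, hk x hx y hy⟩) (fun x hx => ?_) hp
  rw [← hk x hx y hy]
  exact hc x hx

variable (I)

/-- Each interval of `H` is crossed from the left by one of `A` that starts to the left of all
of `H`. -/
def LeftDom (A H : Set Y) : Prop :=
  ∀ y ∈ H, ∃ z ∈ A, I.Crosses z y ∧ ∀ h ∈ H, I.L z < I.L h

/-- Each interval of `H` is crossed from the right by one of `A` that ends to the right of all
of `H`. -/
def RightDom (A H : Set Y) : Prop :=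
  ∀ y ∈ H, ∃ z ∈ A, I.Crosses y z ∧ ∀ h ∈ H, I.R h < I.R z

/-! ### Layers of the overlap graph -/

/-- The distance layers of the components of `I.overlapGraph A`, each counted from the interval
of the component that starts first. -/
theorem exists_layers [Finite Y] (A : Set Y) : ∃ (root : Y → Y) (d : Y → ℕ),
    (∀ x y, (I.overlapGraph A).Adj x y → root x = root y ∧ d x ≤ d y + 1) ∧
    (∀ y, d y = 0 → y = root y) ∧
    (∀ y, I.L (root y) ≤ I.L y) ∧
    (∀ y e, d y = e + 1 → ∃ z, (I.overlapGraph A).Adj z y ∧ d z = e) := by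
  classical
  set G := I.overlapGraph A with hG
  have hroot : ∀ y, ∃ r, G.Reachable r y ∧ ∀ z, G.Reachable z y → I.L r ≤ I.L z := fun y =>
    Set.exists_min_image {z | G.Reachable z y} I.L (Set.toFinite _) ⟨y, SimpleGraph.Reachable.rfl⟩
  choose root hr1 hr2 using hroot
  have hadj : ∀ x y, G.Adj x y → root x = root y := fun x y h => I.L_inj <| le_antisymm
    (hr2 x _ ((hr1 y).trans h.symm.reachable)) (hr2 y _ ((hr1 x).trans h.reachable))
  have hd : ∀ x y, G.Adj x y → G.dist (root x) x ≤ G.dist (root y) y + 1 := by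
    intro x y h
    obtain ⟨w, hw⟩ := (hr1 y).exists_walk_length_eq_dist
    rw [hadj x y h, ← hw]
    exact (SimpleGraph.dist_le (w.concat h.symm)).trans (by simp)
  refine ⟨root, fun y => G.dist (root y) y, fun x y h => ⟨hadj x y h, hd x y h⟩, ?_, ?_, ?_⟩
  · intro y hy
    exact ((hr1 y).dist_eq_zero_iff.1 hy).symm
  · exact fun y => hr2 y y SimpleGraph.Reachable.rfl
  · intro y e he
    change G.dist (root y) y = e + 1 at he
    obtain ⟨w, hw⟩ := (hr1 y).symm.exists_walk_length_eq_dist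
    rw [SimpleGraph.dist_comm, he] at hw
    obtain ⟨z, h, w', hw'⟩ : ∃ z, G.Adj y z ∧ ∃ w' : G.Walk z (root y), w'.length = e := by
      generalize root y = r at w
      cases w with
      | nil => simp at hw
      | @cons _ z _ h w => exact ⟨z, h, w, by simpa using hw⟩
    refine ⟨z, h.symm, ?_⟩
    have h1 := hd y z h
    have h2 : G.dist (root z) z ≤ w'.length := by
      rw [SimpleGraph.dist_comm, ← hadj y z h]
      exact SimpleGraph.dist_le w'
    change G.dist (root z) z = e
    omega

/-- If `w` starts before all intervals of a connected set `H`, meets one of them but crosses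
none, then it contains all of them. -/
theorem all_right_lt {A H : Set Y} {w : Y}
    (hH : ∀ x ∈ H, ∀ y ∈ H, (I.overlapGraph A).Reachable x y)
    (hcl : ∀ x ∈ H, ∀ y, (I.overlapGraph A).Adj x y → y ∈ H)
    (hw : ∀ h ∈ H, ¬ I.Overlap w h) (hL : ∀ h ∈ H, I.L w < I.L h) (hR : ∀ h ∈ H, I.R w ≠ I.R h)
    {a : Y} (ha : a ∈ H) (hmeet : I.L a < I.R w) : ∀ h ∈ H, I.R h < I.R w := by
  have key : ∀ h ∈ H, I.L h < I.R w → I.R h < I.R w := fun h hh hm =>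
    lt_of_not_ge fun hle => hw h hh (Or.inl ⟨hL h hh, hm, lt_of_le_of_ne hle (hR h hh)⟩)
  intro h hh
  obtain ⟨p⟩ := hH a ha h hh
  clear hh
  induction p with
  | nil => exact key _ ha hmeet
  | @cons x y _ hxy p ih =>
    have hx := key x ha hmeet
    refine ih (hcl x ha y hxy) ?_
    rcases hxy.2.2 with hc | hc
    · exact hc.2.1.trans hx
    · exact hc.1.trans hmeet

/-- The mirror image of `all_right_lt`. -/
theorem all_lt_left {A H : Set Y} {w : Y}
    (hH : ∀ x ∈ H, ∀ y ∈ H, (I.overlapGraph A).Reachable x y)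
    (hcl : ∀ x ∈ H, ∀ y, (I.overlapGraph A).Adj x y → y ∈ H)
    (hw : ∀ h ∈ H, ¬ I.Overlap w h) (hR : ∀ h ∈ H, I.R h < I.R w) (hL : ∀ h ∈ H, I.L w ≠ I.L h)
    {a : Y} (ha : a ∈ H) (hmeet : I.L w < I.R a) : ∀ h ∈ H, I.L w < I.L h := by
  have key : ∀ h ∈ H, I.L w < I.R h → I.L w < I.L h := fun h hh hm =>
    lt_of_not_ge fun hle => hw h hh (Or.inr ⟨lt_of_le_of_ne hle (hL h hh).symm, hm, hR h hh⟩)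
  intro h hh
  obtain ⟨p⟩ := hH a ha h hh
  clear hh
  induction p with
  | nil => exact key _ ha hmeet
  | @cons x y _ hxy p ih =>
    have hx := key x ha hmeet
    refine ih (hcl x ha y hxy) ?_
    rcases hxy.2.2 with hc | hc
    · exact hmeet.trans hc.2.2
    · exact hx.trans hc.2.1

variable {I}

/-- One round of layering: every other distance layer goes to the same part, and in a connected
piece of a layer each interval is crossed from outside of the span of the piece by an interval of
the previous layer. -/
theorem Good.of_dominated [Finite Y] (hconn : ∀ i B, pat i B → I.Connected B)
    (hst : ∀ A, I.Stabbed A → Good pat 1 A) {N : ℕ} (hN : 1 ≤ N) {A : Set Y}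
    (hl : ∀ H ⊆ A, I.LeftDom A H → Good pat N H) (hr : ∀ H ⊆ A, I.RightDom A H → Good pat N H) :
    Good pat (4 * N) A := by
  obtain ⟨root, d, hadj, hzero, hmin, hpar⟩ := I.exists_layers A
  suffices h : ∀ e : ℕ, Good pat (N + N) {y ∈ A | d y % 2 = e} by
    refine ((h 0).union (h 1)).mono (by omega) fun y hy => ?_
    rcases Nat.mod_two_eq_zero_or_one (d y) with h | h
    · exact Or.inl ⟨hy, h⟩
    · exact Or.inr ⟨hy, h⟩
  intro e
  set A' := {y ∈ A | d y % 2 = e} with hA'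
  set G' := I.overlapGraph A' with hG'
  refine Good.of_components hconn (fun y => G'.connectedComponentMk y) (fun x hx y hy h =>
    SimpleGraph.ConnectedComponent.eq.2 (SimpleGraph.Adj.reachable ⟨hx, hy, h⟩)) fun k => ?_
  set H := {y ∈ A' | G'.connectedComponentMk y = k} with hHdef
  have hHA : ∀ y ∈ H, y ∈ A := fun y hy => hy.1.1
  have hreach : ∀ x ∈ H, ∀ y ∈ H, G'.Reachable x y := fun x hx y hy =>
    SimpleGraph.ConnectedComponent.eq.1 (hx.2.trans hy.2.symm)
  have hcl : ∀ x ∈ H, ∀ y, G'.Adj x y → y ∈ H := fun x hx y h =>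
    ⟨h.2.1, (SimpleGraph.ConnectedComponent.eq.2 h.symm.reachable).trans hx.2⟩
  -- adjacent intervals of `A'` are in neighbouring layers of equal parity, hence in one layer
  have hconst : ∀ x ∈ H, ∀ y ∈ H, d x = d y ∧ root x = root y := by
    intro x hx y hy
    obtain ⟨p⟩ := hreach x hx y hy
    clear hx hy
    induction p with
    | nil => exact ⟨rfl, rfl⟩
    | @cons x y _ h p ih =>
      have h1 : (I.overlapGraph A).Adj x y := ⟨h.1.1, h.2.1.1, h.2.2⟩
      have h2 := hadj x y h1
      have h3 := hadj y x h1.symm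
      have h4 : d x % 2 = e := h.1.2
      have h5 : d y % 2 = e := h.2.1.2
      exact ⟨by omega, h2.1.trans ih.2⟩
  rcases H.eq_empty_or_nonempty with hHe | ⟨y₀, hy₀⟩
  · rw [hHe]
    exact (hst ∅ (by simp [Stabbed])).mono (by omega) subset_rfl
  -- a piece of the layer `0` consists of the root only
  rcases hd0 : d y₀ with _ | m
  · refine (hst H fun x hx y hy => ?_).mono (by omega) subset_rfl
    have hx0 := hconst x hx y₀ hy₀
    have hy0 := hconst y hy y₀ hy₀
    rw [hzero x (by omega), hzero y (by omega), hx0.2, hy0.2]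
    exact I.L_lt_R _
  have hdH : ∀ h ∈ H, d h = m + 1 := fun h hh => (hconst h hh y₀ hy₀).1.trans hd0
  have hout : ∀ w, d w ≤ m → w ∉ H := fun w hw hwH => by have := hdH w hwH; omega
  -- no interval of an earlier layer lies within the span of `H`
  have hspan : ∀ n w, d w = n → n ≤ m → root w = root y₀ →
      (∀ h ∈ H, I.L w < I.L h) ∨ (∀ h ∈ H, I.R h < I.R w) := by
    intro n
    induction n with
    | zero =>
      intro w hw _ hrw
      refine Or.inl fun h hh => ?_
      rw [hzero w hw, hrw, ← (hconst h hh y₀ hy₀).2]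
      refine lt_of_le_of_ne (hmin h) fun heq => hout w (by omega) ?_
      rw [hzero w hw, hrw, ← (hconst h hh y₀ hy₀).2, I.L_inj heq]
      exact hh
    | succ n ih =>
      intro w hw hn hrw
      obtain ⟨w', hw', hdw'⟩ := hpar w n hw
      have hno : ∀ h ∈ H, ¬ I.Overlap w' h := fun h hh ho => by
        have h1 := (hadj h w' ⟨hHA h hh, hw'.1, ho.symm⟩).2
        have h2 := hdH h hh
        omega
      have hneL : ∀ h ∈ H, I.L w' ≠ I.L h := fun h hh heq =>
        hout w' (by omega) (I.L_inj heq ▸ hh)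
      have hneR : ∀ h ∈ H, I.R w' ≠ I.R h := fun h hh heq =>
        hout w' (by omega) (I.R_inj heq ▸ hh)
      by_contra hcon
      push Not at hcon
      obtain ⟨⟨h₁, hh₁, hle₁⟩, ⟨h₂, hh₂, hle₂⟩⟩ := hcon
      rcases ih w' hdw' (by omega) ((hadj w' w hw').1.trans hrw) with hL | hR
      · have h1 := (hL h₁ hh₁).trans_le hle₁
        rcases hw'.2.2 with hc | hc
        · have := I.all_right_lt hreach hcl hno hL hneR hh₁ (hle₁.trans_lt hc.2.1) h₂ hh₂
          exact absurd (this.trans hc.2.2) (not_lt.2 hle₂)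
        · exact absurd hc.1 (not_lt.2 h1.le)
      · have h1 := hle₂.trans_lt (hR h₂ hh₂)
        rcases hw'.2.2 with hc | hc
        · exact absurd hc.2.2 (not_lt.2 h1.le)
        · have := I.all_lt_left hreach hcl hno hR hneL hh₂ (hc.2.1.trans_le hle₂) h₁ hh₁
          exact absurd (hc.1.trans this) (not_lt.2 hle₁)
  set Hl := {y ∈ H | ∃ z ∈ A, I.Crosses z y ∧ ∀ h ∈ H, I.L z < I.L h} with hHl
  set Hr := {y ∈ H | ∃ z ∈ A, I.Crosses y z ∧ ∀ h ∈ H, I.R h < I.R z} with hHr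
  have h1 : Good pat N Hl := hl Hl (fun y hy => hHA y hy.1) fun y hy => by
    obtain ⟨hyH, z, hz, hc, hall⟩ := hy
    exact ⟨z, hz, hc, fun h hh => hall h hh.1⟩
  have h2 : Good pat N Hr := hr Hr (fun y hy => hHA y hy.1) fun y hy => by
    obtain ⟨hyH, z, hz, hc, hall⟩ := hy
    exact ⟨z, hz, hc, fun h hh => hall h hh.1⟩
  refine (h1.union h2).mono le_rfl fun y hy => ?_
  obtain ⟨z, hz, hdz⟩ := hpar y m (hdH y hy)
  rcases hspan m z hdz le_rfl ((hadj z y hz).1.trans (hconst y hy y₀ hy₀).2) with hL | hR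
  · rcases hz.2.2 with hc | hc
    · exact Or.inl ⟨hy, z, hz.1, hc, hL⟩
    · exact absurd (hL y hy) (not_lt.2 hc.1.le)
  · rcases hz.2.2 with hc | hc
    · exact absurd (hR y hy) (not_lt.2 hc.2.2.le)
    · exact Or.inr ⟨hy, z, hz.1, hc, hR⟩

variable (I)

/-! ### Iterated layering -/

/-- `H` arises by `m` rounds of layering in which a part with crossings from the left was chosen;
before, between and after these rounds one may pass to subsets. -/
def LeftRich : ℕ → Set Y → Prop
  | 0, _ => True
  | m + 1, H => ∃ A, H ⊆ A ∧ LeftRich m A ∧ I.LeftDom A H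

/-- `H` arises by `m` rounds of layering in which a part with crossings from the right was chosen;
before, between and after these rounds one may pass to subsets. -/
def RightRich : ℕ → Set Y → Prop
  | 0, _ => True
  | m + 1, H => ∃ A, H ⊆ A ∧ RightRich m A ∧ I.RightDom A H

/-- `u 0, …, u (n - 1)` are pairwise disjoint intervals of `H`, from left to right. -/
def IsChain (n : ℕ) (H : Set Y) (u : ℕ → Y) : Prop :=
  (∀ i < n, u i ∈ H) ∧ ∀ i j, i < j → j < n → I.R (u i) < I.L (u j)

variable {I}

theorem LeftRich.mono : ∀ {m : ℕ} {A B : Set Y}, I.LeftRich m B → A ⊆ B → I.LeftRich m A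
  | 0, _, _, _, _ => trivial
  | _ + 1, _, _, ⟨C, hC, hr, hd⟩, hA => ⟨C, hA.trans hC, hr, fun y hy => by
      obtain ⟨z, hz, hc, hall⟩ := hd y (hA hy)
      exact ⟨z, hz, hc, fun h hh => hall h (hA hh)⟩⟩

theorem RightRich.mono : ∀ {m : ℕ} {A B : Set Y}, I.RightRich m B → A ⊆ B → I.RightRich m A
  | 0, _, _, _, _ => trivial
  | _ + 1, _, _, ⟨C, hC, hr, hd⟩, hA => ⟨C, hA.trans hC, hr, fun y hy => by
      obtain ⟨z, hz, hc, hall⟩ := hd y (hA hy)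
      exact ⟨z, hz, hc, fun h hh => hall h (hA hh)⟩⟩

/-- After `m` rounds there are `m` intervals that start in the order of the rounds, while their
right ends can be prescribed up to the choice of an interval of `H`. -/
theorem LeftRich.exists_crossing : ∀ {m : ℕ} {H : Set Y}, I.LeftRich m H → ∀ u : ℕ → Y,
    (∀ j < m, u j ∈ H) → ∃ z : ℕ → Y, (∀ i j, i < j → j < m → I.L (z i) < I.L (z j)) ∧
      ∀ j < m, (∀ h ∈ H, I.L (z j) < I.L h) ∧ I.Crosses (z j) (u j)
  | 0, _, _, u, _ => ⟨u, by simp, by simp⟩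
  | m + 1, H, ⟨A, hA, hr, hd⟩, u, hu => by
    obtain ⟨z, hz1, hz2⟩ := hr.exists_crossing u fun j hj => hA (hu j (by omega))
    obtain ⟨y, hy, hc, hall⟩ := hd (u m) (hu m (by omega))
    refine ⟨Function.update z m y, fun i j hij hj => ?_, fun j hj => ?_⟩
    · rw [Function.update_of_ne (by omega : i ≠ m)]
      rcases Nat.lt_succ_iff_lt_or_eq.1 hj with hj | rfl
      · rw [Function.update_of_ne hj.ne]; exact hz1 i j hij hj
      · rw [Function.update_self]; exact (hz2 i hij).1 y hy
    · rcases Nat.lt_succ_iff_lt_or_eq.1 hj with hj | rfl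
      · rw [Function.update_of_ne hj.ne]
        exact ⟨fun h hh => (hz2 j hj).1 h (hA hh), (hz2 j hj).2⟩
      · rw [Function.update_self]; exact ⟨hall, hc⟩

/-- The mirror image of `LeftRich.exists_crossing`. -/
theorem RightRich.exists_crossing : ∀ {m : ℕ} {H : Set Y}, I.RightRich m H → ∀ u : ℕ → Y,
    (∀ j < m, u j ∈ H) → ∃ z : ℕ → Y, (∀ i j, i < j → j < m → I.R (z j) < I.R (z i)) ∧
      ∀ j < m, (∀ h ∈ H, I.R h < I.R (z j)) ∧ I.Crosses (u j) (z j)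
  | 0, _, _, u, _ => ⟨u, by simp, by simp⟩
  | m + 1, H, ⟨A, hA, hr, hd⟩, u, hu => by
    obtain ⟨z, hz1, hz2⟩ := hr.exists_crossing u fun j hj => hA (hu j (by omega))
    obtain ⟨y, hy, hc, hall⟩ := hd (u m) (hu m (by omega))
    refine ⟨Function.update z m y, fun i j hij hj => ?_, fun j hj => ?_⟩
    · rw [Function.update_of_ne (by omega : i ≠ m)]
      rcases Nat.lt_succ_iff_lt_or_eq.1 hj with hj | rfl
      · rw [Function.update_of_ne hj.ne]; exact hz1 i j hij hj
      · rw [Function.update_self]; exact (hz2 i hij).1 y hy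
    · rcases Nat.lt_succ_iff_lt_or_eq.1 hj with hj | rfl
      · rw [Function.update_of_ne hj.ne]
        exact ⟨fun h hh => (hz2 j hj).1 h (hA hh), (hz2 j hj).2⟩
      · rw [Function.update_self]; exact ⟨hall, hc⟩

variable (I)

/-- The intervals `z 0, …, z (n - 1)` have a common point and form the pattern `τ`, where
intervals are read as points with the left end as position, and with values decreasing in the
right end. -/
def IsStabbedCopy {n : ℕ} (τ : Equiv.Perm (Fin n)) (z : Fin n → Y) : Prop :=
  (∀ i j, i < j → I.L (z i) < I.L (z j)) ∧ (∀ i j, τ i < τ j → I.R (z j) < I.R (z i)) ∧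
    ∀ i j, I.L (z i) < I.R (z j)

variable {I}

/-- `n` disjoint intervals and `n` rounds from the left produce every pattern of size `n`: the
rounds give the positions, and the disjoint intervals the values. -/
theorem LeftRich.exists_copy {n : ℕ} {H : Set Y} (hr : I.LeftRich n H) {u : ℕ → Y}
    (hu : I.IsChain n H u) (τ : Equiv.Perm (Fin n)) : ∃ z, I.IsStabbedCopy τ z := by
  obtain ⟨z, hz1, hz2⟩ := hr.exists_crossing
    (fun j => if h : j < n then u (n - 1 - (τ ⟨j, h⟩ : ℕ)) else u j) fun j hj => by
      simp only [hj, dif_pos]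
      exact hu.1 _ (by omega)
  have hc : ∀ i : Fin n, I.Crosses (z i) (u (n - 1 - (τ i : ℕ))) := fun i => by
    simpa only [i.2, dif_pos] using (hz2 i i.2).2
  refine ⟨fun i => z i, fun i j hij => hz1 i j hij j.2, fun i j hij => ?_, fun i j => ?_⟩
  · refine (hc j).2.2.trans ((hu.2 _ _ ?_ ?_).trans (hc i).2.1)
    · have := (τ j).2
      have : (τ i : ℕ) < τ j := hij
      omega
    · have := (τ i).2
      omega
  · exact ((hz2 i i.2).1 _ (hu.1 (n - 1 - (τ j : ℕ)) (by have := (τ j).2; omega))).trans (hc j).2.1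

/-- `n` disjoint intervals and `n` rounds from the right produce every pattern of size `n`: the
rounds give the values, and the disjoint intervals the positions. -/
theorem RightRich.exists_copy {n : ℕ} {H : Set Y} (hr : I.RightRich n H) {u : ℕ → Y}
    (hu : I.IsChain n H u) (τ : Equiv.Perm (Fin n)) : ∃ z, I.IsStabbedCopy τ z := by
  obtain ⟨z, hz1, hz2⟩ := hr.exists_crossing
    (fun j => if h : j < n then u (τ.symm ⟨j, h⟩) else u j) fun j hj => by
      simp only [hj, dif_pos]
      exact hu.1 _ (Fin.is_lt _)
  have hc : ∀ i : Fin n, I.Crosses (u i) (z (τ i)) := fun i => by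
    simpa only [(τ i).2, dif_pos, Fin.eta, Equiv.symm_apply_apply] using (hz2 (τ i) (τ i).2).2
  refine ⟨fun i => z (τ i), fun i j hij => ?_, fun i j hij => hz1 _ _ hij (τ j).2, fun i j => ?_⟩
  · exact (hc i).2.1.trans ((hu.2 i j hij j.2).trans (hc j).1)
  · exact (hc i).2.1.trans ((hz2 (τ j) (τ j).2).1 _ (hu.1 i i.2))

/-- Intervals without `n + 1` pairwise disjoint ones among them can be pierced by `n + 1` points:
the right ends of a greedily chosen disjoint subfamily. -/
theorem Good.of_no_chain [Finite Y] (hst : ∀ A, I.Stabbed A → Good pat 1 A) :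
    ∀ (n : ℕ) (H : Set Y), (¬ ∃ u, I.IsChain (n + 1) H u) → Good pat (n + 1) H
  | n, H, hH => by
    rcases H.eq_empty_or_nonempty with rfl | hne
    · exact (hst ∅ (by simp [Stabbed])).mono (by omega) subset_rfl
    obtain ⟨y, hy, hmin⟩ := Set.exists_min_image H I.R H.toFinite hne
    cases n with
    | zero => exact absurd ⟨fun _ => y, fun _ _ => hy, by omega⟩ hH
    | succ n =>
      have h1 : Good pat (n + 1) {h ∈ H | I.R y < I.L h} := by
        refine Good.of_no_chain hst n _ fun ⟨u, hu⟩ => hH ⟨fun i => Nat.casesOn i y u, ?_, ?_⟩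
        · rintro (_ | i) hi
          · exact hy
          · exact (hu.1 i (by omega)).1
        · rintro (_ | i) (_ | j) hij hj
          · omega
          · exact (hu.1 j (by omega)).2
          · omega
          · exact hu.2 i j (by omega) (by omega)
      -- the intervals that start before the earliest right end all contain that end
      have h2 : Good pat 1 {h ∈ H | I.L h < I.R y} :=
        hst _ fun a ha b hb => ha.2.trans_le (hmin b hb.1)
      refine (h1.union h2).mono le_rfl fun h hh => ?_
      rcases lt_or_ge (I.L h) (I.R y) with hlt | hge
      · exact Or.inr ⟨hh, hlt⟩
      · exact Or.inl ⟨hh, lt_of_le_of_ne hge (I.L_ne_R h y).symm⟩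

/-- A family of intervals that has no stabbed copy of a pattern `τ` of size `n`, and whose stabbed
subfamilies can be coloured with one palette, can be coloured with a number of palettes that
depends on `n` only. For decreasing `τ` this bounds the chromatic number of circle graphs in terms
of the clique number. -/
theorem Good.of_no_copy [Finite Y] (hconn : ∀ i B, pat i B → I.Connected B)
    (hst : ∀ A, I.Stabbed A → Good pat 1 A) {n : ℕ} (hn : 1 ≤ n) (τ : Equiv.Perm (Fin n))
    (hτ : ¬ ∃ z, I.IsStabbedCopy τ z) (A : Set Y) : Good pat (4 ^ (2 * n) * n) A := by
  have hpos : ∀ s : ℕ, n ≤ 4 ^ s * n := fun s => Nat.le_mul_of_pos_left n (by positivity)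
  have hbase : ∀ A, (I.LeftRich n A ∨ I.RightRich n A) → Good pat n A := by
    intro A hA
    obtain ⟨m, rfl⟩ : ∃ m, n = m + 1 := ⟨n - 1, by omega⟩
    refine Good.of_no_chain hst m A fun ⟨u, hu⟩ => hτ ?_
    rcases hA with h | h
    · exact h.exists_copy hu τ
    · exact h.exists_copy hu τ
  have main : ∀ s p q A, p ≤ n → q ≤ n → p + q + s = 2 * n → I.LeftRich p A → I.RightRich q A →
      Good pat (4 ^ s * n) A := by
    intro s
    induction s with
    | zero =>
      intro p q A hp hq hs hl _
      obtain rfl : p = n := by omega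
      exact (hbase A (Or.inl hl)).mono (hpos 0) subset_rfl
    | succ s ih =>
      intro p q A hp hq hs hl hr
      by_cases hpn : p = n
      · exact (hbase A (Or.inl (hpn ▸ hl))).mono (hpos _) subset_rfl
      by_cases hqn : q = n
      · exact (hbase A (Or.inr (hqn ▸ hr))).mono (hpos _) subset_rfl
      have := Good.of_dominated hconn hst (hn.trans (hpos s)) (A := A)
        (fun H hH hd => ih (p + 1) q H (by omega) hq (by omega) ⟨A, hH, hl, hd⟩ (hr.mono hH))
        (fun H hH hd => ih p (q + 1) H hp (by omega) (by omega) (hl.mono hH) ⟨A, hH, hr, hd⟩)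
      rwa [pow_succ', mul_assoc]
  exact main (2 * n) 0 0 A (by omega) (by omega) (by omega) trivial trivial

end IntervalFamily

/-! ### Separable patterns as binary trees -/

/-- Terms for non-empty separable permutations: `leaf` is the singleton, `node true` the sum and
`node false` the skew sum. Different terms may describe the same permutation. -/
inductive SepTree : Type
  | leaf : SepTree
  | node (s : Bool) (a b : SepTree) : SepTree

namespace SepTree

/-- The number of leaves. -/
def size : SepTree → ℕ
  | leaf => 1
  | node _ a b => a.size + b.size

/-- The term of the complement: sums and skew sums are exchanged. -/
def flip : SepTree → SepTree
  | leaf => leaf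
  | node s a b => node (!s) a.flip b.flip

/-- The term of the reverse complement. -/
def rev : SepTree → SepTree
  | leaf => leaf
  | node s a b => node s b.rev a.rev

theorem size_pos : ∀ t : SepTree, 0 < t.size
  | leaf => Nat.one_pos
  | node _ a _ => Nat.add_pos_left a.size_pos _

theorem size_flip : ∀ t : SepTree, t.flip.size = t.size
  | leaf => rfl
  | node s a b => by simp [flip, size, a.size_flip, b.size_flip]

theorem size_rev : ∀ t : SepTree, t.rev.size = t.size
  | leaf => rfl
  | node s a b => by simp [rev, size, a.size_rev, b.size_rev, Nat.add_comm]

theorem flip_flip : ∀ t : SepTree, t.flip.flip = t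
  | leaf => rfl
  | node s a b => by simp [flip, a.flip_flip, b.flip_flip]

theorem rev_rev : ∀ t : SepTree, t.rev.rev = t
  | leaf => rfl
  | node s a b => by simp [rev, a.rev_rev, b.rev_rev]

section Realizes

variable {Y Y' : Type} (p v : Y → ℤ) (p' v' : Y' → ℤ)

/-- With `p` as positions and `v` as values, `y` lies to the right of `x`, and above it if `s` is
`true`, below it if `s` is `false`. -/
def Before (s : Bool) (x y : Y) : Prop := p x < p y ∧ if s then v x < v y else v y < v x

/-- With `p` as positions and `v` as values, the set `A` forms the pattern `t`. -/
def Realizes : SepTree → Set Y → Prop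
  | leaf, A => ∃ y, A = {y}
  | node s a b, A => ∃ B C, A = B ∪ C ∧ Realizes a B ∧ Realizes b C ∧
      ∀ x ∈ B, ∀ y ∈ C, Before p v s x y

/-- Some subset of `S` forms the pattern `t`. -/
def Contains (t : SepTree) (S : Set Y) : Prop := ∃ A ⊆ S, Realizes p v t A

variable {p v p' v'}

theorem before_true {x y : Y} : Before p v true x y ↔ p x < p y ∧ v x < v y := by simp [Before]

theorem before_false {x y : Y} : Before p v false x y ↔ p x < p y ∧ v y < v x := by simp [Before]

theorem Realizes.nonempty : ∀ {t : SepTree} {A : Set Y}, Realizes p v t A → A.Nonempty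
  | leaf, _, ⟨y, h⟩ => ⟨y, by simp [h]⟩
  | node _ _ _, _, ⟨_, _, h, hB, _, _⟩ => by
      obtain ⟨y, hy⟩ := hB.nonempty
      exact ⟨y, by simp [h, hy]⟩

theorem Contains.mono {t : SepTree} {S T : Set Y} (h : Contains p v t S) (hST : S ⊆ T) :
    Contains p v t T := h.imp fun _ hA => ⟨hA.1.trans hST, hA.2⟩

theorem Realizes.image (f : Y → Y') : ∀ {t : SepTree} {A : Set Y}, Realizes p v t A →
    (∀ x ∈ A, ∀ y ∈ A, (p x < p y → p' (f x) < p' (f y)) ∧ (v x < v y → v' (f x) < v' (f y))) →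
    Realizes p' v' t (f '' A)
  | leaf, _, ⟨y, h⟩, _ => ⟨f y, by simp [h]⟩
  | node s a b, A, ⟨B, C, h, hB, hC, hBC⟩, hf => by
      subst h
      refine ⟨f '' B, f '' C, Set.image_union .., hB.image f fun x hx y hy => ?_,
        hC.image f fun x hx y hy => ?_, ?_⟩
      · exact hf x (Or.inl hx) y (Or.inl hy)
      · exact hf x (Or.inr hx) y (Or.inr hy)
      · rintro _ ⟨x, hx, rfl⟩ _ ⟨y, hy, rfl⟩
        have h1 := hBC x hx y hy
        have h2 := hf x (Or.inl hx) y (Or.inr hy)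
        have h3 := hf y (Or.inr hy) x (Or.inl hx)
        refine ⟨h2.1 h1.1, ?_⟩
        cases s
        · simpa using h3.2 (by simpa using h1.2)
        · simpa using h2.2 (by simpa using h1.2)

/-- Two sets with the same pattern are matched by a map that preserves both orders. -/
theorem Realizes.exists_map : ∀ {t : SepTree} {A : Set Y} {A' : Set Y'}, Realizes p v t A →
    Realizes p' v' t A' → ∃ f : Y → Y', (∀ x ∈ A, f x ∈ A') ∧
      ∀ x ∈ A, ∀ y ∈ A, (p x < p y → p' (f x) < p' (f y)) ∧ (v x < v y → v' (f x) < v' (f y))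
  | leaf, _, _, ⟨a, h⟩, ⟨a', h'⟩ => by
      subst h h'
      refine ⟨fun _ => a', fun _ _ => rfl, ?_⟩
      rintro x rfl y rfl
      exact ⟨fun h => absurd h (lt_irrefl _), fun h => absurd h (lt_irrefl _)⟩
  | node s a b, _, _, ⟨B, C, h, hB, hC, hBC⟩, ⟨B', C', h', hB', hC', hBC'⟩ => by
      classical
      subst h h'
      obtain ⟨f, hf1, hf2⟩ := hB.exists_map hB'
      obtain ⟨g, hg1, hg2⟩ := hC.exists_map hC'
      refine ⟨fun x => if x ∈ B then f x else g x, fun x hx => ?_, fun x hx y hy => ?_⟩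
      · by_cases hxB : x ∈ B
        · simpa [hxB] using Or.inl (hf1 x hxB)
        · simpa [hxB] using Or.inr (hg1 x (hx.resolve_left hxB))
      · by_cases hxB : x ∈ B <;> by_cases hyB : y ∈ B
        · simpa [hxB, hyB] using hf2 x hxB y hyB
        · have hyC := hy.resolve_left hyB
          have h1 := hBC x hxB y hyC
          have h2 := hBC' _ (hf1 x hxB) _ (hg1 y hyC)
          simp only [hxB, hyB, if_true, if_false]
          cases s
          · rw [before_false] at h1 h2
            exact ⟨fun _ => h2.1, fun h => absurd h h1.2.asymm⟩
          · rw [before_true] at h1 h2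
            exact ⟨fun _ => h2.1, fun _ => h2.2⟩
        · have hxC := hx.resolve_left hxB
          have h1 := hBC y hyB x hxC
          have h2 := hBC' _ (hf1 y hyB) _ (hg1 x hxC)
          simp only [hxB, hyB, if_true, if_false]
          cases s
          · rw [before_false] at h1 h2
            exact ⟨fun h => absurd h h1.1.asymm, fun _ => h2.2⟩
          · rw [before_true] at h1 h2
            exact ⟨fun h => absurd h h1.1.asymm, fun h => absurd h h1.2.asymm⟩
        · simpa [hxB, hyB] using
            hg2 x (hx.resolve_left hxB) y (hy.resolve_left hyB)

theorem Realizes.flip : ∀ {t : SepTree} {A : Set Y}, Realizes p v t A →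
    Realizes p (fun y => -v y) t.flip A
  | leaf, _, h => h
  | node s a b, A, ⟨B, C, h, hB, hC, hBC⟩ => ⟨B, C, h, hB.flip, hC.flip, fun x hx y hy => by
      have := hBC x hx y hy
      cases s <;> simpa [Before] using this⟩

theorem Realizes.rev : ∀ {t : SepTree} {A : Set Y}, Realizes p v t A →
    Realizes (fun y => -p y) (fun y => -v y) t.rev A
  | leaf, _, h => h
  | node s a b, A, ⟨B, C, h, hB, hC, hBC⟩ =>
    ⟨C, B, h.trans (Set.union_comm _ _), hC.rev, hB.rev, fun x hx y hy => by
      have := hBC y hy x hx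
      cases s <;> simpa [Before] using this⟩

theorem contains_flip {t : SepTree} {S : Set Y} :
    Contains p (fun y => -v y) t.flip S ↔ Contains p v t S := by
  refine ⟨fun ⟨A, hA, h⟩ => ⟨A, hA, ?_⟩, fun ⟨A, hA, h⟩ => ⟨A, hA, h.flip⟩⟩
  simpa [flip_flip] using h.flip

theorem contains_rev {t : SepTree} {S : Set Y} :
    Contains (fun y => -p y) (fun y => -v y) t.rev S ↔ Contains p v t S := by
  refine ⟨fun ⟨A, hA, h⟩ => ⟨A, hA, ?_⟩, fun ⟨A, hA, h⟩ => ⟨A, hA, h.rev⟩⟩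
  simpa [rev_rev] using h.rev

theorem Contains.node {s : Bool} {a b : SepTree} {B C S : Set Y} (hB : Realizes p v a B)
    (hC : Realizes p v b C) (hBS : B ⊆ S) (hCS : C ⊆ S)
    (h : ∀ x ∈ B, ∀ y ∈ C, Before p v s x y) : Contains p v (.node s a b) S :=
  ⟨B ∪ C, Set.union_subset hBS hCS, B, C, rfl, hB, hC, h⟩

end Realizes

/-- Every point set that contains `t` contains `s`. -/
def Le (s t : SepTree) : Prop :=
  ∀ (Y : Type) (p v : Y → ℤ) (S : Set Y), Contains p v t S → Contains p v s S

theorem Le.trans {r s t : SepTree} (h : Le r s) (h' : Le s t) : Le r t :=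
  fun Y p v S hS => h Y p v S (h' Y p v S hS)

theorem leaf_le (t : SepTree) : Le leaf t := fun _ _ _ _ ⟨_, hA, h⟩ => by
  obtain ⟨y, hy⟩ := h.nonempty
  exact ⟨{y}, Set.singleton_subset_iff.2 (hA hy), y, rfl⟩

theorem Le.refl (t : SepTree) : Le t t := fun _ _ _ _ h => h

theorem Le.node {a b a' b' : SepTree} (s : Bool) (ha : Le a a') (hb : Le b b') :
    Le (node s a b) (node s a' b') := by
  rintro Y p v S ⟨_, hA, B, C, rfl, hB, hC, hBC⟩
  obtain ⟨B₁, hB₁, hB₁'⟩ := ha Y p v B ⟨B, subset_rfl, hB⟩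
  obtain ⟨C₁, hC₁, hC₁'⟩ := hb Y p v C ⟨C, subset_rfl, hC⟩
  exact Contains.node hB₁' hC₁' (hB₁.trans (Set.union_subset_iff.1 hA).1)
    (hC₁.trans (Set.union_subset_iff.1 hA).2) fun x hx y hy => hBC x (hB₁ hx) y (hC₁ hy)

theorem le_node_left (s : Bool) (a b : SepTree) : Le a (.node s a b) := by
  rintro Y p v S ⟨_, hA, B, C, rfl, hB, hC, hBC⟩
  exact ⟨B, (Set.union_subset_iff.1 hA).1, hB⟩

theorem Le.flip {s t : SepTree} (h : Le s t) : Le s.flip t.flip := fun Y p v S hS => by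
  have := h Y p (fun y => -v y) S (by simpa [flip_flip] using contains_flip.2 hS)
  simpa using contains_flip.2 this

theorem Le.rev {s t : SepTree} (h : Le s t) : Le s.rev t.rev := fun Y p v S hS => by
  have := h Y (fun y => -p y) (fun y => -v y) S (by simpa [rev_rev] using contains_rev.2 hS)
  simpa using contains_rev.2 this

/-- The terms of the slim permutations other than the singleton, with the sign of the root. -/
inductive Slim : Bool → SepTree → Prop
  | pair (s : Bool) : Slim s (node s leaf leaf)
  | left {s : Bool} {t : SepTree} : Slim (!s) t → Slim s (node s t leaf)
  | right {s : Bool} {t : SepTree} : Slim (!s) t → Slim s (node s leaf t)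

theorem Slim.exists_node {s : Bool} {t : SepTree} (h : Slim s t) : ∃ a b, t = node s a b := by
  cases h <;> exact ⟨_, _, rfl⟩

theorem Slim.flip {s : Bool} {t : SepTree} (h : Slim s t) : Slim (!s) t.flip := by
  induction h with
  | pair s => exact .pair _
  | left _ ih => exact .left ih
  | right _ ih => exact .right ih

theorem Slim.rev {s : Bool} {t : SepTree} (h : Slim s t) : Slim s t.rev := by
  induction h with
  | pair s => exact .pair _
  | left _ ih => exact .right ih
  | right _ ih => exact .left ih

/-! ### Splittings between principal classes -/

/-- The class of the permutations that avoid `t` is contained in the merge of the classes of the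
permutations that avoid `f i`, where `i` runs over `ι` and the `f i` are contained in `t`. -/
def SplitsOver (t : SepTree) {ι : Type} (f : ι → SepTree) : Prop :=
  (∀ i, Le (f i) t) ∧ ∀ (Y : Type) [Finite Y] (p v : Y → ℤ), Function.Injective p →
    Function.Injective v → ∀ S : Set Y, ¬ Contains p v t S →
      ∃ c : Y → ι, ∀ i, ¬ Contains p v (f i) {y ∈ S | c y = i}

/-- The class of the permutations that avoid `t` is splittable over the classes of the
permutations that avoid a slim permutation with root sign `s` that is contained in `t`. -/
def Splits (s : Bool) (t : SepTree) : Prop :=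
  ∃ (ι : Type) (_ : Finite ι) (f : ι → SepTree), (∀ i, Slim s (f i)) ∧ SplitsOver t f

theorem Slim.splits {s : Bool} {t : SepTree} (h : Slim s t) : Splits s t :=
  ⟨Unit, inferInstance, fun _ => t, fun _ => h, fun _ => Le.refl t,
    fun _ _ _ _ _ _ _ hS => ⟨fun _ => (), fun _ hc => hS (hc.mono fun _ hy => hy.1)⟩⟩

theorem SplitsOver.splits {s : Bool} {t : SepTree} {κ : Type} [Finite κ] {g : κ → SepTree}
    (hg : SplitsOver t g) (h : ∀ k, Splits s (g k)) : Splits s t := by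
  choose ι hι f hf hs using h
  refine ⟨Σ k, ι k, inferInstance, fun i => f i.1 i.2, fun i => hf _ _,
    fun i => ((hs i.1).1 i.2).trans (hg.1 i.1), fun Y _ p v hp hv S hS => ?_⟩
  obtain ⟨c, hc⟩ := hg.2 Y p v hp hv S hS
  choose d hd using fun k => (hs k).2 Y p v hp hv _ (hc k)
  refine ⟨fun y => ⟨c y, d (c y) y⟩, ?_⟩
  rintro ⟨k, i⟩ hcon
  refine hd k i (hcon.mono ?_)
  rintro y ⟨hy, h⟩
  obtain ⟨rfl, h⟩ := Sigma.mk.inj_iff.1 h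
  exact ⟨⟨hy, rfl⟩, eq_of_heq h⟩

theorem Splits.flip {s : Bool} {t : SepTree} (h : Splits s t) : Splits (!s) t.flip := by
  obtain ⟨ι, hι, f, hf, hle, hs⟩ := h
  refine ⟨ι, hι, fun i => (f i).flip, fun i => (hf i).flip, fun i => (hle i).flip,
    fun Y _ p v hp hv S hS => ?_⟩
  obtain ⟨c, hc⟩ := hs Y p (fun y => -v y) hp (neg_injective.comp hv) S fun h => hS <| by
    simpa using contains_flip.2 h
  exact ⟨c, fun i hi => hc i <| by simpa [flip_flip] using contains_flip.2 hi⟩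

theorem Splits.rev {s : Bool} {t : SepTree} (h : Splits s t) : Splits s t.rev := by
  obtain ⟨ι, hι, f, hf, hle, hs⟩ := h
  refine ⟨ι, hι, fun i => (f i).rev, fun i => (hf i).rev, fun i => (hle i).rev,
    fun Y _ p v hp hv S hS => ?_⟩
  obtain ⟨c, hc⟩ := hs Y (fun y => -p y) (fun y => -v y) (neg_injective.comp hp)
    (neg_injective.comp hv) S fun h => hS <| by simpa using contains_rev.2 h
  exact ⟨c, fun i hi => hc i <| by simpa [rev_rev] using contains_rev.2 hi⟩

/-- `Av(a ⊕ b) ⊆ Av(a ⊕ 1) ⊙ Av(1 ⊕ b)`: the elements with a copy of `a` below and to the left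
are separated from the others. -/
theorem splitsOver_two (a b : SepTree) : SplitsOver (node true a b)
    (fun i : Bool => if i then node true a leaf else node true leaf b) := by
  classical
  refine ⟨fun i => ?_, fun Y _ p v _ _ S hS => ?_⟩
  · cases i
    · exact Le.node true (leaf_le a) (Le.refl b)
    · exact Le.node true (Le.refl a) (leaf_le b)
  refine ⟨fun y => decide (¬ ∃ A ⊆ S, Realizes p v a A ∧ ∀ x ∈ A, Before p v true x y), fun i => ?_⟩
  cases i
  · rintro ⟨_, hA, _, C, rfl, ⟨y, rfl⟩, hC, hBC⟩
    rw [Set.union_subset_iff] at hA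
    obtain ⟨A, hAS, hA', hAy⟩ : ∃ A ⊆ S, Realizes p v a A ∧ ∀ x ∈ A, Before p v true x y := by
      simpa only [decide_eq_false_iff_not, not_not] using (hA.1 rfl).2
    refine hS (Contains.node hA' hC hAS (fun z hz => (hA.2 hz).1) fun x hx z hz => ?_)
    have h1 := before_true.1 (hAy x hx)
    have h2 := before_true.1 (hBC y rfl z hz)
    exact before_true.2 ⟨h1.1.trans h2.1, h1.2.trans h2.2⟩
  · rintro ⟨_, hA, B, _, rfl, hB, ⟨y, rfl⟩, hBC⟩
    rw [Set.union_subset_iff] at hA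
    exact of_decide_eq_true (hA.2 rfl).2
      ⟨B, fun z hz => (hA.1 hz).1, hB, fun x hx => hBC x hx y rfl⟩

/-- A set may be defined by recursion from left to right. -/
theorem exists_set_of_recursion {Y : Type} [Finite Y] (p : Y → ℤ) (Φ : Y → Set Y → Prop) :
    ∃ R : Set Y, ∀ y, y ∈ R ↔ Φ y {z ∈ R | p z < p y} := by
  have wf : WellFounded fun x y : Y => p x < p y := by
    have : IsTrans Y fun x y => p x < p y := ⟨fun _ _ _ => lt_trans⟩
    have : Std.Irrefl fun x y : Y => p x < p y := ⟨fun _ => lt_irrefl _⟩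
    exact Finite.wellFounded_of_trans_of_irrefl _
  let F : Y → Prop := wf.fix fun y ih => Φ y {z | ∃ h : p z < p y, ih z h}
  refine ⟨{y | F y}, fun y => ?_⟩
  change F y ↔ _
  rw [show F y = Φ y {z | ∃ _ : p z < p y, F z} from wf.fix_eq _ y]
  have : {z | ∃ _ : p z < p y, F z} = {z ∈ {y | F y} | p z < p y} := by
    ext z; simp [and_comm]
  rw [this]

/-- `Av(a ⊕ b ⊕ c) ⊆ Av(a ⊕ b) ⊙ Av(b ⊕ c)`: going from left to right, an element is made red
unless it lies above and to the right of a blue element or completes a red copy of `a ⊕ b`. -/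
theorem splitsOver_three (a b c : SepTree) : SplitsOver (node true (node true a b) c)
    (fun i : Bool => if i then node true a b else node true b c) := by
  classical
  refine ⟨fun i => ?_, fun Y _ p v hp hv S hS => ?_⟩
  · cases i
    · rintro Y p v S ⟨_, hA, _, C, rfl, ⟨A, B, rfl, hA', hB, hAB⟩, hC, hBC⟩
      simp only [Set.union_subset_iff] at hA
      exact Contains.node hB hC hA.1.2 hA.2 fun x hx y hy => hBC x (Or.inr hx) y hy
    · exact le_node_left _ _ _
  obtain ⟨Rd, hRd⟩ := exists_set_of_recursion p fun y R =>
    (∀ z ∈ S, Before p v true z y → z ∈ R) ∧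
      ¬ Contains p v (node true a b) (insert y {z ∈ S | z ∈ R})
  have hred : ¬ Contains p v (node true a b) {y ∈ S | y ∈ Rd} := by
    rintro ⟨A, hA, hr⟩
    obtain ⟨y, hy, hmax⟩ := Set.exists_max_image A p A.toFinite hr.nonempty
    refine ((hRd y).1 (hA hy).2).2 ⟨A, fun z hz => ?_, hr⟩
    rcases eq_or_ne z y with rfl | hne
    · exact Or.inl rfl
    · exact Or.inr ⟨(hA hz).1, (hA hz).2, lt_of_le_of_ne (hmax z hz) (hp.ne hne)⟩
  refine ⟨fun y => decide (y ∈ Rd), fun i => ?_⟩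
  cases i
  swap
  · simpa using hred
  rintro ⟨_, hA, B, C, rfl, hB, hC, hBC⟩
  rw [Set.union_subset_iff] at hA
  have hBS : ∀ x ∈ B, x ∈ S := fun x hx => (hA.1 hx).1
  have hCS : ∀ x ∈ C, x ∈ S := fun x hx => (hA.2 hx).1
  have hBR : ∀ x ∈ B, x ∉ Rd := fun x hx => of_decide_eq_false (hA.1 hx).2
  -- the lowest element `b₀` of the copy of `b`, and a blue element `b₁` below and to the left of
  -- it (or equal to it) that was made blue because it completed a red copy of `a ⊕ b`
  obtain ⟨b₀, hb₀, hlow⟩ := Set.exists_min_image B v B.toFinite hB.nonempty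
  obtain ⟨b₁, ⟨hb₁S, hb₁R, hpb, hvb⟩, hfirst⟩ := Set.exists_min_image
    {z | z ∈ S ∧ z ∉ Rd ∧ p z ≤ p b₀ ∧ v z ≤ v b₀} p (Set.toFinite _)
    ⟨b₀, hBS b₀ hb₀, hBR b₀ hb₀, le_rfl, le_rfl⟩
  have hcomp : Contains p v (node true a b)
      (insert b₁ {z ∈ S | z ∈ {z ∈ Rd | p z < p b₁}}) := by
    by_contra hno
    refine hb₁R ((hRd b₁).2 ⟨fun z hz hzb => ?_, hno⟩)
    rw [before_true] at hzb
    refine ⟨by_contra fun hzR => ?_, hzb.1⟩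
    exact absurd (hfirst z ⟨hz, hzR, hzb.1.le.trans hpb, hzb.2.le.trans hvb⟩) (not_le.2 hzb.1)
  obtain ⟨_, hAB, A, B', rfl, hA', hB', hAB'⟩ := hcomp
  have hmem : ∀ z ∈ A ∪ B', z ∈ S ∧ p z ≤ p b₁ ∧ (z ≠ b₁ → z ∈ Rd) := by
    intro z hz
    rcases hAB hz with rfl | h
    · exact ⟨hb₁S, le_rfl, fun h => absurd rfl h⟩
    · exact ⟨h.1, h.2.2.le, fun _ => h.2.1⟩
  have hAB'' := fun x hx y hy => before_true.1 (hAB' x hx y hy)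
  have hBC' := fun x hx y hy => before_true.1 (hBC x hx y hy)
  obtain ⟨x₀, hx₀⟩ := hB'.nonempty
  have hb₁B : b₁ ∈ B' := by
    by_contra hnB
    refine hred ⟨A ∪ B', fun z hz => ⟨(hmem z hz).1, (hmem z hz).2.2 ?_⟩, A, B', rfl, hA', hB', hAB'⟩
    rintro rfl
    rcases hz with hz | hz
    · exact absurd ((hmem x₀ (Or.inr hx₀)).2.1) (not_le.2 (hAB'' z hz x₀ hx₀).1)
    · exact hnB hz
  have hAS : A ⊆ S := fun x hx => (hmem x (Or.inl hx)).1
  have hB'S : B' ⊆ S := fun x hx => (hmem x (Or.inr hx)).1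
  by_cases hleft : ∀ s ∈ A, ∀ u ∈ B, p s < p u
  · -- the copy of `a` is below and to the left of the blue copy of `b`
    have hs : ∀ s ∈ A, ∀ u ∈ B, v s < v u := fun s hs u hu =>
      ((hAB'' s hs b₁ hb₁B).2.trans_le hvb).trans_le (hlow u hu)
    refine hS (Contains.node (B := A ∪ B) (C := C) ⟨A, B, rfl, hA', hB, fun s hs' u hu =>
      before_true.2 ⟨hleft s hs' u hu, hs s hs' u hu⟩⟩ hC (Set.union_subset hAS hBS) hCS ?_)
    rintro x (hx | hx) y hy
    · have h := hBC' b₀ hb₀ y hy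
      exact before_true.2 ⟨(hleft x hx b₀ hb₀).trans h.1, (hs x hx b₀ hb₀).trans h.2⟩
    · exact hBC x hx y hy
  · -- otherwise the red copy of `a ⊕ b` is below and to the left of the copy of `c`
    push Not at hleft
    obtain ⟨s, hs, u, hu, hus⟩ := hleft
    have hB'u : ∀ t ∈ B', v t ≤ v u := by
      intro t ht
      rcases eq_or_ne t b₁ with rfl | hne
      · exact hvb.trans (hlow u hu)
      · by_contra hlt
        have htR := (hRd t).1 ((hmem t (Or.inr ht)).2.2 hne)
        exact hBR u hu (htR.1 u (hBS u hu) (before_true.2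
          ⟨hus.trans_lt (hAB'' s hs t ht).1, not_le.1 hlt⟩)).1
    have hB'C : ∀ t ∈ B', ∀ y ∈ C, p t < p y ∧ v t < v y := fun t ht y hy =>
      ⟨(((hmem t (Or.inr ht)).2.1).trans hpb).trans_lt (hBC' b₀ hb₀ y hy).1,
        (hB'u t ht).trans_lt (hBC' u hu y hy).2⟩
    refine hS (Contains.node (B := A ∪ B') (C := C) ⟨A, B', rfl, hA', hB', hAB'⟩ hC
      (Set.union_subset hAS hB'S) hCS ?_)
    rintro x (hx | hx) y hy
    · have h := hB'C b₁ hb₁B y hy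
      have h' := hAB'' x hx b₁ hb₁B
      exact before_true.2 ⟨h'.1.trans h.1, h'.2.trans h.2⟩
    · exact before_true.2 (hB'C x hx y hy)

end SepTree

/-! ### Permutations described by terms -/

namespace FinPerm

/-- The positions of the elements of `π`. -/
def pos (π : FinPerm) (i : Fin π.size) : ℤ := (i : ℕ)

/-- The values of the elements of `π`. -/
def val (π : FinPerm) (i : Fin π.size) : ℤ := (π.perm i : ℕ)

theorem pos_lt {π : FinPerm} {i j : Fin π.size} : π.pos i < π.pos j ↔ i < j := by
  simp [pos]

theorem val_lt {π : FinPerm} {i j : Fin π.size} : π.val i < π.val j ↔ π.perm i < π.perm j := by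
  simp [val]

theorem pos_injective (π : FinPerm) : Function.Injective π.pos := fun i j h => by
  simpa [pos, Fin.ext_iff] using h

theorem val_injective (π : FinPerm) : Function.Injective π.val := fun i j h => by
  simpa [val, ← Fin.ext_iff] using h

/-- `π` is the permutation described by the term `t`. -/
def HasTree (π : FinPerm) (t : SepTree) : Prop := SepTree.Realizes π.pos π.val t Set.univ

variable {α β : FinPerm}

theorem pos_nonneg (i : Fin α.size) : 0 ≤ α.pos i := Int.natCast_nonneg _

theorem pos_lt_size (i : Fin α.size) : α.pos i < α.size := Int.ofNat_lt.2 i.2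

theorem val_nonneg (i : Fin α.size) : 0 ≤ α.val i := Int.natCast_nonneg _

theorem val_lt_size (i : Fin α.size) : α.val i < α.size := Int.ofNat_lt.2 (α.perm i).2

/-- The elements of the left summand, as elements of the sum. -/
def sumInl (α β : FinPerm) : Fin α.size → Fin (α.sum β).size := Fin.castAdd β.size

/-- The elements of the right summand, as elements of the sum. -/
def sumInr (α β : FinPerm) : Fin β.size → Fin (α.sum β).size := Fin.natAdd α.size

/-- The elements of the left summand, as elements of the skew sum. -/
def skewInl (α β : FinPerm) : Fin α.size → Fin (α.skewSum β).size := Fin.castAdd β.size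

/-- The elements of the right summand, as elements of the skew sum. -/
def skewInr (α β : FinPerm) : Fin β.size → Fin (α.skewSum β).size := Fin.natAdd α.size

theorem pos_sumInl (i : Fin α.size) : (α.sum β).pos (sumInl α β i) = α.pos i := rfl

theorem pos_sumInr (i : Fin β.size) : (α.sum β).pos (sumInr α β i) = β.pos i + α.size :=
  (Int.natCast_add _ _).trans (add_comm _ _)

theorem pos_skewInl (i : Fin α.size) : (α.skewSum β).pos (skewInl α β i) = α.pos i := rfl

theorem pos_skewInr (i : Fin β.size) : (α.skewSum β).pos (skewInr α β i) = β.pos i + α.size :=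
  (Int.natCast_add _ _).trans (add_comm _ _)

theorem val_sumInl (i : Fin α.size) : (α.sum β).val (sumInl α β i) = α.val i := by
  change (((finSumFinEquiv (Equiv.sumCongr α.perm β.perm
    (finSumFinEquiv.symm (Fin.castAdd β.size i))) : Fin _) : ℕ) : ℤ) = ((α.perm i : ℕ) : ℤ)
  simp

theorem val_sumInr (i : Fin β.size) : (α.sum β).val (sumInr α β i) = β.val i + α.size := by
  change (((finSumFinEquiv (Equiv.sumCongr α.perm β.perm
    (finSumFinEquiv.symm (Fin.natAdd α.size i))) : Fin _) : ℕ) : ℤ) = ((β.perm i : ℕ) : ℤ) + α.size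
  simp [add_comm]

theorem val_skewInl (i : Fin α.size) :
    (α.skewSum β).val (skewInl α β i) = α.val i + β.size := by
  change (((finSumFinEquiv ((Equiv.sumComm _ _) (Equiv.sumCongr α.perm β.perm
    (finSumFinEquiv.symm (Fin.castAdd β.size i)))) : Fin _) : ℕ) : ℤ) =
      ((α.perm i : ℕ) : ℤ) + β.size
  simp [add_comm]

theorem val_skewInr (i : Fin β.size) : (α.skewSum β).val (skewInr α β i) = β.val i := by
  change (((finSumFinEquiv ((Equiv.sumComm _ _) (Equiv.sumCongr α.perm β.perm
    (finSumFinEquiv.symm (Fin.natAdd α.size i)))) : Fin _) : ℕ) : ℤ) = ((β.perm i : ℕ) : ℤ)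
  simp

theorem range_sumInl_union_range_sumInr (α β : FinPerm) :
    Set.range (sumInl α β) ∪ Set.range (sumInr α β) = Set.univ :=
  Set.eq_univ_of_forall fun i =>
    Fin.addCases (fun i => Or.inl ⟨i, rfl⟩) (fun i => Or.inr ⟨i, rfl⟩) i

theorem range_skewInl_union_range_skewInr (α β : FinPerm) :
    Set.range (skewInl α β) ∪ Set.range (skewInr α β) = Set.univ :=
  Set.eq_univ_of_forall fun i =>
    Fin.addCases (fun i => Or.inl ⟨i, rfl⟩) (fun i => Or.inr ⟨i, rfl⟩) i

/-- A translate of the point set of `α` forms every pattern that `α` forms. -/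
theorem HasTree.range {Y : Type} {p v : Y → ℤ} {t : SepTree} (h : α.HasTree t)
    (f : Fin α.size → Y) (c d : ℤ) (hp : ∀ i, p (f i) = α.pos i + c)
    (hv : ∀ i, v (f i) = α.val i + d) : SepTree.Realizes p v t (Set.range f) := by
  rw [← Set.image_univ]
  refine SepTree.Realizes.image f h fun x _ y _ => ?_
  rw [hp, hp, hv, hv]
  exact ⟨fun h => add_lt_add_left h c, fun h => add_lt_add_left h d⟩

theorem HasTree.sumInl {a : SepTree} (h : α.HasTree a) (β : FinPerm) :
    SepTree.Realizes (α.sum β).pos (α.sum β).val a (Set.range (sumInl α β)) :=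
  h.range _ 0 0 (fun i => by rw [pos_sumInl, add_zero]) fun i => by rw [val_sumInl, add_zero]

theorem HasTree.sumInr {b : SepTree} (h : β.HasTree b) (α : FinPerm) :
    SepTree.Realizes (α.sum β).pos (α.sum β).val b (Set.range (sumInr α β)) :=
  h.range _ _ _ pos_sumInr val_sumInr

theorem HasTree.skewInl {a : SepTree} (h : α.HasTree a) (β : FinPerm) :
    SepTree.Realizes (α.skewSum β).pos (α.skewSum β).val a (Set.range (skewInl α β)) :=
  h.range _ 0 _ (fun i => by rw [pos_skewInl, add_zero]) val_skewInl

theorem HasTree.skewInr {b : SepTree} (h : β.HasTree b) (α : FinPerm) :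
    SepTree.Realizes (α.skewSum β).pos (α.skewSum β).val b (Set.range (skewInr α β)) :=
  h.range _ _ 0 pos_skewInr fun i => by rw [val_skewInr, add_zero]

theorem HasTree.sum {a b : SepTree} (ha : α.HasTree a) (hb : β.HasTree b) :
    (α.sum β).HasTree (.node true a b) := by
  refine ⟨_, _, (range_sumInl_union_range_sumInr α β).symm, ha.sumInl β, hb.sumInr α, ?_⟩
  rintro _ ⟨x, rfl⟩ _ ⟨y, rfl⟩
  rw [SepTree.before_true, pos_sumInl, pos_sumInr, val_sumInl, val_sumInr]
  have := pos_lt_size x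
  have := val_lt_size x
  have := pos_nonneg y
  have := val_nonneg y
  omega

theorem HasTree.skewSum {a b : SepTree} (ha : α.HasTree a) (hb : β.HasTree b) :
    (α.skewSum β).HasTree (.node false a b) := by
  refine ⟨_, _, (range_skewInl_union_range_skewInr α β).symm, ha.skewInl β, hb.skewInr α, ?_⟩
  rintro _ ⟨x, rfl⟩ _ ⟨y, rfl⟩
  rw [SepTree.before_false, pos_skewInl, pos_skewInr, val_skewInl, val_skewInr]
  have := pos_lt_size x
  have := val_nonneg x
  have := pos_nonneg y
  have := val_lt_size y
  omega

theorem hasTree_one : one.HasTree .leaf :=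
  ⟨(0 : Fin 1), Set.eq_singleton_iff_unique_mem.2 ⟨trivial, fun _ _ =>
    Subsingleton.elim (α := Fin 1) _ _⟩⟩

theorem IsSeparable.exists_hasTree {π : FinPerm} (h : π.IsSeparable) :
    π.size = 0 ∨ ∃ t, π.HasTree t := by
  induction h with
  | empty => exact Or.inl rfl
  | one => exact Or.inr ⟨_, hasTree_one⟩
  | @sum σ τ _ _ ihσ ihτ =>
    rcases ihσ with hσ | ⟨a, ha⟩ <;> rcases ihτ with hτ | ⟨b, hb⟩
    · exact Or.inl (by simp [FinPerm.sum, hσ, hτ])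
    · refine Or.inr ⟨b, ?_⟩
      have : IsEmpty (Fin σ.size) := by rw [hσ]; infer_instance
      have h := range_sumInl_union_range_sumInr σ τ
      rw [Set.range_eq_empty, Set.empty_union] at h
      have hr := hb.sumInr σ
      rwa [h] at hr
    · refine Or.inr ⟨a, ?_⟩
      have : IsEmpty (Fin τ.size) := by rw [hτ]; infer_instance
      have h := range_sumInl_union_range_sumInr σ τ
      rw [Set.range_eq_empty (sumInr σ τ), Set.union_empty] at h
      have hr := ha.sumInl τ
      rwa [h] at hr
    · exact Or.inr ⟨_, ha.sum hb⟩
  | @skewSum σ τ _ _ ihσ ihτ =>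
    rcases ihσ with hσ | ⟨a, ha⟩ <;> rcases ihτ with hτ | ⟨b, hb⟩
    · exact Or.inl (by simp [FinPerm.skewSum, hσ, hτ])
    · refine Or.inr ⟨b, ?_⟩
      have : IsEmpty (Fin σ.size) := by rw [hσ]; infer_instance
      have h := range_skewInl_union_range_skewInr σ τ
      rw [Set.range_eq_empty, Set.empty_union] at h
      have hr := hb.skewInr σ
      rwa [h] at hr
    · refine Or.inr ⟨a, ?_⟩
      have : IsEmpty (Fin τ.size) := by rw [hτ]; infer_instance
      have h := range_skewInl_union_range_skewInr σ τ
      rw [Set.range_eq_empty (skewInr σ τ), Set.union_empty] at h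
      have hr := ha.skewInl τ
      rwa [h] at hr
    · exact Or.inr ⟨_, ha.skewSum hb⟩

theorem le_iff_contains {σ π : FinPerm} {t : SepTree} (h : σ.HasTree t) :
    σ ≤ π ↔ SepTree.Contains π.pos π.val t Set.univ := by
  constructor
  · rintro ⟨_, f, -, hf⟩
    refine ⟨f '' Set.univ, Set.subset_univ _, SepTree.Realizes.image f h fun x _ y _ => ⟨?_, ?_⟩⟩
    · rw [pos_lt, pos_lt]; exact f.lt_iff_lt.2
    · rw [val_lt, val_lt]; exact (hf x y).1
  · rintro ⟨A, -, hA⟩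
    obtain ⟨f, -, hf⟩ := SepTree.Realizes.exists_map h hA
    have hmono : StrictMono f := fun x y hxy =>
      pos_lt.1 ((hf x trivial y trivial).1 (pos_lt.2 hxy))
    have hval : ∀ x y, σ.perm x < σ.perm y → π.perm (f x) < π.perm (f y) := fun x y hxy =>
      val_lt.1 ((hf x trivial y trivial).2 (val_lt.2 hxy))
    refine ⟨_, OrderEmbedding.ofStrictMono f hmono, rfl, fun i j => ⟨hval i j, fun h => ?_⟩⟩
    rcases lt_trichotomy (σ.perm i) (σ.perm j) with h' | h' | h'
    · exact h'
    · obtain rfl := σ.perm.injective h'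
      exact absurd h (lt_irrefl _)
    · exact absurd h (hval j i h').asymm

/-- In a sum of two non-empty permutations the first element is below the last one. -/
theorem IsSumDecomposable.first_lt_last {π : FinPerm} (h : π.IsSumDecomposable)
    {i j : Fin π.size} (hi : (i : ℕ) = 0) (hj : (j : ℕ) + 1 = π.size) : π.perm i < π.perm j := by
  obtain ⟨α, β, hα, hβ, rfl⟩ := h
  have hs : (α.sum β).size = α.size + β.size := rfl
  obtain rfl : i = sumInl α β ⟨0, hα⟩ := Fin.ext hi
  obtain rfl : j = sumInr α β ⟨β.size - 1, Nat.sub_lt hβ one_pos⟩ := Fin.ext <| by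
    change (j : ℕ) = α.size + (β.size - 1)
    omega
  rw [← val_lt, val_sumInl, val_sumInr]
  have h₁ := val_lt_size (α := α) ⟨0, hα⟩
  have h₂ := val_nonneg (α := β) ⟨β.size - 1, Nat.sub_lt hβ one_pos⟩
  omega

/-- In a skew sum of two non-empty permutations the last element is below the first one. -/
theorem IsSkewDecomposable.last_lt_first {π : FinPerm} (h : π.IsSkewDecomposable)
    {i j : Fin π.size} (hi : (i : ℕ) = 0) (hj : (j : ℕ) + 1 = π.size) : π.perm j < π.perm i := by
  obtain ⟨α, β, hα, hβ, rfl⟩ := h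
  have hs : (α.skewSum β).size = α.size + β.size := rfl
  obtain rfl : i = skewInl α β ⟨0, hα⟩ := Fin.ext hi
  obtain rfl : j = skewInr α β ⟨β.size - 1, Nat.sub_lt hβ one_pos⟩ := Fin.ext <| by
    change (j : ℕ) = α.size + (β.size - 1)
    omega
  rw [← val_lt, val_skewInl, val_skewInr]
  have h₁ := val_nonneg (α := α) ⟨0, hα⟩
  have h₂ := val_lt_size (α := β) ⟨β.size - 1, Nat.sub_lt hβ one_pos⟩
  omega

theorem not_isSumDecomposable_of_size_one {π : FinPerm} (h : π.size = 1) :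
    ¬ π.IsSumDecomposable := by
  rintro ⟨α, β, hα, hβ, rfl⟩
  simp only [FinPerm.sum] at h
  omega

theorem not_isSkewDecomposable_of_size_one {π : FinPerm} (h : π.size = 1) :
    ¬ π.IsSkewDecomposable := by
  rintro ⟨α, β, hα, hβ, rfl⟩
  simp only [FinPerm.skewSum] at h
  omega

theorem not_sumDecomposable_and_skewDecomposable {π : FinPerm} (h : π.IsSumDecomposable)
    (h' : π.IsSkewDecomposable) : False := by
  have hpos : 0 < π.size := by
    obtain ⟨α, β, hα, hβ, rfl⟩ := h
    exact Nat.add_pos_left hα _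
  have h1 := h.first_lt_last (i := ⟨0, hpos⟩) (j := ⟨π.size - 1, by omega⟩) rfl (by simp; omega)
  have h2 := h'.last_lt_first (i := ⟨0, hpos⟩) (j := ⟨π.size - 1, by omega⟩) rfl (by simp; omega)
  exact h1.asymm h2

theorem sum_empty (σ : FinPerm) : σ.sum empty = σ := by
  refine congrArg (FinPerm.mk σ.size) (Equiv.ext fun i => Fin.ext ?_)
  exact Int.ofNat_inj.1 (val_sumInl (β := empty) i)

theorem skewSum_empty (σ : FinPerm) : σ.skewSum empty = σ := by
  refine congrArg (FinPerm.mk σ.size) (Equiv.ext fun i => Fin.ext ?_)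
  exact Int.ofNat_inj.1 ((val_skewInl (β := empty) i).trans (add_zero _))

/-- A sum-decomposable permutation that is described by a term is described by one whose root is
a sum. -/
theorem HasTree.exists_sum {π : FinPerm} {t : SepTree} (h : π.HasTree t)
    (hdec : π.IsSumDecomposable) : ∃ a b, t = .node true a b := by
  have h2 : 2 ≤ π.size := by
    obtain ⟨α, β, hα, hβ, rfl⟩ := hdec
    exact Nat.add_le_add hα hβ
  let i : Fin π.size := ⟨0, by omega⟩
  let j : Fin π.size := ⟨π.size - 1, by omega⟩
  match t, h with
  | .leaf, ⟨y, hy⟩ =>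
    have hi : i = y := by simpa [hy] using Set.mem_univ i
    have hj : j = y := by simpa [hy] using Set.mem_univ j
    have := congrArg Fin.val (hi.trans hj.symm)
    simp only [i, j] at this
    omega
  | .node true a b, _ => exact ⟨a, b, rfl⟩
  | .node false a b, ⟨B, C, hU, hB, hC, hBC⟩ =>
    obtain ⟨x, hx⟩ := hB.nonempty
    obtain ⟨y, hy⟩ := hC.nonempty
    have hi : i ∈ B := by
      rcases (hU ▸ Set.mem_univ i : i ∈ B ∪ C) with hi | hi
      · exact hi
      · have := pos_lt.1 (hBC x hx i hi).1
        simp [i, Fin.lt_def] at this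
    have hj : j ∈ C := by
      rcases (hU ▸ Set.mem_univ j : j ∈ B ∪ C) with hj | hj
      · have := pos_lt.1 (hBC j hj y hy).1
        simp only [j, Fin.lt_def] at this
        have := y.2
        omega
      · exact hj
    have h1 := hdec.first_lt_last (i := i) (j := j) rfl (by simp only [j]; omega)
    have h2 := val_lt.1 (SepTree.before_false.1 (hBC i hi j hj)).2
    exact absurd h1 h2.asymm

end FinPerm

namespace SepTree

/-- The permutation described by a term. -/
def eval : SepTree → FinPerm
  | leaf => FinPerm.one
  | node true a b => a.eval.sum b.eval
  | node false a b => a.eval.skewSum b.eval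

theorem hasTree_eval : ∀ t : SepTree, t.eval.HasTree t
  | leaf => FinPerm.hasTree_one
  | node true a b => a.hasTree_eval.sum b.hasTree_eval
  | node false a b => a.hasTree_eval.skewSum b.hasTree_eval

theorem isSeparable_eval : ∀ t : SepTree, t.eval.IsSeparable
  | leaf => .one
  | node true a b => a.isSeparable_eval.sum b.isSeparable_eval
  | node false a b => a.isSeparable_eval.skewSum b.isSeparable_eval

theorem eval_size_pos (t : SepTree) : 0 < t.eval.size := by
  obtain ⟨y, -⟩ := t.hasTree_eval.nonempty
  exact y.pos

theorem isSumDecomposable_eval (a b : SepTree) : (node true a b).eval.IsSumDecomposable :=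
  ⟨a.eval, b.eval, a.eval_size_pos, b.eval_size_pos, rfl⟩

theorem isSkewDecomposable_eval (a b : SepTree) : (node false a b).eval.IsSkewDecomposable :=
  ⟨a.eval, b.eval, a.eval_size_pos, b.eval_size_pos, rfl⟩

theorem Slim.not_isSumDecomposable {t : SepTree} (h : Slim false t) :
    ¬ t.eval.IsSumDecomposable := fun h' => by
  obtain ⟨a, b, rfl⟩ := h.exists_node
  exact FinPerm.not_sumDecomposable_and_skewDecomposable h' (isSkewDecomposable_eval a b)

theorem Slim.not_isSkewDecomposable {t : SepTree} (h : Slim true t) :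
    ¬ t.eval.IsSkewDecomposable := fun h' => by
  obtain ⟨a, b, rfl⟩ := h.exists_node
  exact FinPerm.not_sumDecomposable_and_skewDecomposable (isSumDecomposable_eval a b) h'

open DecompTree in
theorem represents_sum {a b : SepTree} {T U : DecompTree} (hT : T.Represents a.eval)
    (hU : U.Represents b.eval) (ha : ¬ a.eval.IsSumDecomposable)
    (hb : ¬ b.eval.IsSumDecomposable) :
    (plusNode 2 ![T, U]).Represents (node true a b).eval := by
  have h := Represents.plusNode le_rfl ![T, U] ![a.eval, b.eval]
    (by simp [Fin.forall_fin_two, ha, hb]) (by simp [Fin.forall_fin_two, hT, hU])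
  simpa [FinPerm.listSum, FinPerm.sum_empty, eval] using h

open DecompTree in
theorem represents_skewSum {a b : SepTree} {T U : DecompTree} (hT : T.Represents a.eval)
    (hU : U.Represents b.eval) (ha : ¬ a.eval.IsSkewDecomposable)
    (hb : ¬ b.eval.IsSkewDecomposable) :
    (minusNode 2 ![T, U]).Represents (node false a b).eval := by
  have h := Represents.minusNode le_rfl ![T, U] ![a.eval, b.eval]
    (by simp [Fin.forall_fin_two, ha, hb]) (by simp [Fin.forall_fin_two, hT, hU])
  simpa [FinPerm.listSkewSum, FinPerm.skewSum_empty, eval] using h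

open DecompTree in
theorem Slim.exists_represents {s : Bool} {t : SepTree} (h : Slim s t) :
    ∃ T : DecompTree, T.Represents t.eval ∧ T.IsSlim := by
  have h1 := FinPerm.not_isSumDecomposable_of_size_one (π := FinPerm.one) rfl
  have h2 := FinPerm.not_isSkewDecomposable_of_size_one (π := FinPerm.one) rfl
  have hleaf : DecompTree.leaf.Represents SepTree.leaf.eval := Represents.leaf
  induction h with
  | pair s =>
    cases s
    · exact ⟨_, represents_skewSum hleaf hleaf h2 h2, rfl, ⟨0, rfl⟩,
        by simp [Fin.forall_fin_two, DecompTree.IsSlim]⟩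
    · exact ⟨_, represents_sum hleaf hleaf h1 h1, rfl, ⟨0, rfl⟩,
        by simp [Fin.forall_fin_two, DecompTree.IsSlim]⟩
  | @left s t ht ih =>
    obtain ⟨T, hT, hTs⟩ := ih
    cases s
    · exact ⟨_, represents_skewSum hT hleaf ht.not_isSkewDecomposable h2, rfl, ⟨1, rfl⟩,
        by simp [Fin.forall_fin_two, DecompTree.IsSlim, hTs]⟩
    · exact ⟨_, represents_sum hT hleaf ht.not_isSumDecomposable h1, rfl, ⟨1, rfl⟩,
        by simp [Fin.forall_fin_two, DecompTree.IsSlim, hTs]⟩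
  | @right s t ht ih =>
    obtain ⟨T, hT, hTs⟩ := ih
    cases s
    · exact ⟨_, represents_skewSum hleaf hT h2 ht.not_isSkewDecomposable, rfl, ⟨0, rfl⟩,
        by simp [Fin.forall_fin_two, DecompTree.IsSlim, hTs]⟩
    · exact ⟨_, represents_sum hleaf hT h1 ht.not_isSumDecomposable, rfl, ⟨0, rfl⟩,
        by simp [Fin.forall_fin_two, DecompTree.IsSlim, hTs]⟩

theorem Slim.isSlim_eval {s : Bool} {t : SepTree} (h : Slim s t) : t.eval.IsSlim :=
  ⟨t.isSeparable_eval, h.exists_represents⟩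

/-! ### Adding a largest last element -/

/-- If `Av(a)` is splittable over classes `Av(σ)` with slim skew-decomposable `σ`, then `Av(a ⊕ 1)`
is splittable over the classes `Av(σ ⊕ 1)`.

The elements without another one above and to the right of them avoid `12`. Any other element `y`
is assigned the interval from its position to the position of the last element above it. Elements
have a common element above and to the right of them if and only if their intervals have a common
point, and two such elements form an inversion if and only if their intervals cross. -/
theorem Splits.node_leaf {a : SepTree} (h : Splits false a) : Splits true (node true a leaf) := by
  classical
  obtain ⟨ι, hι, f, hf, hle, hs⟩ := h
  set n := a.eval.size with hn
  refine ⟨Option (Fin (4 ^ (2 * n) * n) × ι), inferInstance,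
    fun o => o.elim (node true leaf leaf) fun i => node true (f i.2) leaf, ?_, ?_, ?_⟩
  · rintro (_ | i)
    · exact .pair _
    · exact .left (hf i.2)
  · rintro (_ | i)
    · exact Le.node true (leaf_le a) (Le.refl leaf)
    · exact Le.node true (hle i.2) (Le.refl leaf)
  intro Y _ p v hp hv S hS
  let Y' := {y : Y // y ∈ S ∧ ∃ x ∈ S, p y < p x ∧ v y < v x}
  have htop : ∀ y : Y', ∃ x, (x ∈ S ∧ v y.1 < v x) ∧ ∀ x', x' ∈ S ∧ v y.1 < v x' → p x' ≤ p x :=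
    fun y => Set.exists_max_image {x | x ∈ S ∧ v y.1 < v x} p (Set.toFinite _)
      (by obtain ⟨x, hx, h⟩ := y.2.2; exact ⟨x, hx, h.2⟩)
  -- `top y` is the last element above `y`
  choose top htop hmax using htop
  have hlt : ∀ y : Y', p y.1 < p (top y) := fun y => by
    obtain ⟨x, hx, h⟩ := y.2.2
    exact h.1.trans_le (hmax y x ⟨hx, h.2⟩)
  have hne : ∀ x y : Y', p x.1 ≠ p (top y) := fun x y he => by
    obtain ⟨x', hx', h⟩ := x.2.2
    have hxy := hp he
    have := hmax y x' ⟨hx', (htop y).2.trans (hxy ▸ h.2)⟩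
    exact absurd (he ▸ h.1) (not_lt.2 this)
  -- the second coordinate only breaks ties between intervals with the same right end
  let L : Y' → ℤ ×ₗ ℤ := fun y => toLex (p y.1, 0)
  let R : Y' → ℤ ×ₗ ℤ := fun y => toLex (p (top y), -v y.1)
  have hLL : ∀ x y : Y', L x < L y ↔ p x.1 < p y.1 := fun x y => by
    simp [L, Prod.Lex.toLex_lt_toLex]
  have hLR : ∀ x y : Y', L x < R y ↔ p x.1 < p (top y) := fun x y => by
    simp [L, R, Prod.Lex.toLex_lt_toLex, hne]
  have hRR : ∀ x y : Y', v y.1 < v x.1 → R x < R y := fun x y hxy => by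
    have h1 := hmax y (top x) ⟨(htop x).1, hxy.trans (htop x).2⟩
    rcases h1.lt_or_eq with h1 | h1
    · simp [R, Prod.Lex.toLex_lt_toLex, h1]
    · simp [R, Prod.Lex.toLex_lt_toLex, h1, hxy]
  let I : IntervalFamily Y' (ℤ ×ₗ ℤ) :=
    { L := L
      R := R
      L_inj := fun x y he => by
        have he : (p x.1, (0 : ℤ)) = (p y.1, 0) := toLex_inj.1 he
        exact Subtype.ext (hp (Prod.ext_iff.1 he).1)
      R_inj := fun x y he => by
        have he : (p (top x), -v x.1) = (p (top y), -v y.1) := toLex_inj.1 he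
        exact Subtype.ext (hv (neg_injective (Prod.ext_iff.1 he).2))
      L_lt_R := fun y => (hLR y y).2 (hlt y)
      L_ne_R := fun x y he => by
        have he : (p x.1, (0 : ℤ)) = (p (top y), -v y.1) := toLex_inj.1 he
        exact hne x y (Prod.ext_iff.1 he).1 }
  let p' : Y' → ℤ := fun y => p y.1
  let v' : Y' → ℤ := fun y => v y.1
  have hcommon : ∀ B : Set Y', B.Nonempty → I.Stabbed B →
      ∃ x ∈ S, ∀ b ∈ B, p b.1 < p x ∧ v b.1 < v x := by
    intro B hB hst
    obtain ⟨b₀, hb₀, hmaxb⟩ := Set.exists_max_image B v' B.toFinite hB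
    exact ⟨top b₀, (htop b₀).1, fun b hb =>
      ⟨(hLR b b₀).1 (hst b hb b₀ hb₀), (hmaxb b hb).trans_lt (htop b₀).2⟩⟩
  have havoid : ∀ B : Set Y', I.Stabbed B → ¬ Contains p' v' a B := by
    rintro B hst ⟨B', hB', hr⟩
    obtain ⟨x, hx, hbx⟩ := hcommon B' hr.nonempty fun y hy z hz => hst y (hB' hy) z (hB' hz)
    refine hS (Contains.node (hr.image (p' := p) (v' := v) Subtype.val fun _ _ _ _ => ⟨id, id⟩)
      ⟨x, rfl⟩ ?_ (Set.singleton_subset_iff.2 hx) ?_)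
    · rintro _ ⟨y, -, rfl⟩
      exact y.2.1
    · rintro _ ⟨y, hy, rfl⟩ _ rfl
      exact before_true.2 (hbx y hy)
  have hgood : IntervalFamily.Good (fun i B => I.Stabbed B ∧ Realizes p' v' (f i) B)
      (4 ^ (2 * n) * n) Set.univ := by
    refine IntervalFamily.Good.of_no_copy (I := I) ?_ ?_ (eval_size_pos a) a.eval.perm ?_ Set.univ
    · rintro i B ⟨hst, hr⟩
      refine ⟨hr.nonempty, fun κ g hg => ?_⟩
      obtain ⟨b, c, hbc⟩ := (hf i).exists_node
      rw [hbc] at hr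
      obtain ⟨B, C, rfl, hB, hC, hBC⟩ := hr
      have key : ∀ x ∈ B, ∀ y ∈ C, g x = g y := fun x hx y hy => by
        have h := before_false.1 (hBC x hx y hy)
        exact hg x (Or.inl hx) y (Or.inr hy)
          (Or.inl ⟨(hLL x y).2 h.1, hst y (Or.inr hy) x (Or.inl hx), hRR x y h.2⟩)
      obtain ⟨b₀, hb₀⟩ := hB.nonempty
      obtain ⟨c₀, hc₀⟩ := hC.nonempty
      have key' : ∀ x ∈ B ∪ C, g x = g c₀ := by
        rintro x (hx | hx)
        · exact key x hx c₀ hc₀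
        · exact (key b₀ hb₀ x hx).symm.trans (key b₀ hb₀ c₀ hc₀)
      exact fun x hx y hy => (key' x hx).trans (key' y hy).symm
    · intro A hst
      obtain ⟨c, hc⟩ := hs Y' p' v' (hp.comp Subtype.val_injective) (hv.comp Subtype.val_injective) A
        (havoid A hst)
      refine ⟨fun y => (0, c y), fun _ _ => Nat.one_pos, fun i B hB hBc hr => ?_⟩
      exact hc i.2 ⟨B, fun y hy => ⟨hB hy, (Prod.ext_iff.1 (hBc y hy)).2⟩, hr.2⟩
    · rintro ⟨z, hz1, hz2, hz3⟩
      refine havoid (z '' Set.univ) ?_ ⟨z '' Set.univ, subset_rfl,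
        Realizes.image z (hasTree_eval a) fun i _ j _ => ⟨fun hij => ?_, fun hij => ?_⟩⟩
      · rintro _ ⟨i, -, rfl⟩ _ ⟨j, -, rfl⟩
        exact hz3 i j
      · exact (hLL _ _).1 (hz1 i j (FinPerm.pos_lt.1 hij))
      · by_contra hlt
        rcases (not_lt.1 hlt).lt_or_eq with h | h
        · exact (hz2 i j (FinPerm.val_lt.1 hij)).asymm (hRR _ _ h)
        · have := hz2 i j (FinPerm.val_lt.1 hij)
          rw [Subtype.ext (hv h)] at this
          exact lt_irrefl _ this
  obtain ⟨col, hcolN, hcol⟩ := hgood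
  -- the colour `none` is given to the elements outside of `Y'`, which form no copy of `1 ⊕ 1`
  refine ⟨fun y => if h : y ∈ S ∧ ∃ x ∈ S, p y < p x ∧ v y < v x then
    some (⟨(col ⟨y, h⟩).1, hcolN _ trivial⟩, (col ⟨y, h⟩).2) else none, ?_⟩
  rintro (_ | ⟨c, i⟩)
  · rintro ⟨_, hA, _, _, rfl, ⟨x, rfl⟩, ⟨y, rfl⟩, hxy⟩
    rw [Set.union_subset_iff, Set.singleton_subset_iff, Set.singleton_subset_iff] at hA
    have hx : x ∈ S ∧ ∃ y ∈ S, p x < p y ∧ v x < v y :=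
      ⟨hA.1.1, y, hA.2.1, before_true.1 (hxy x rfl y rfl)⟩
    exact absurd ((dif_pos hx).symm.trans hA.1.2) (by simp)
  · rintro ⟨_, hA, B, _, rfl, hB, ⟨x, rfl⟩, hBx⟩
    rw [Set.union_subset_iff, Set.singleton_subset_iff] at hA
    have hBY : ∀ y ∈ B, y ∈ S ∧ ∃ x ∈ S, p y < p x ∧ v y < v x := fun y hy =>
      ⟨(hA.1 hy).1, x, hA.2.1, before_true.1 (hBx y hy x rfl)⟩
    obtain ⟨b, hb⟩ := hB.nonempty
    let g : Y → Y' := fun y => if h : y ∈ B then ⟨y, hBY y h⟩ else ⟨b, hBY b hb⟩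
    have hg : ∀ y ∈ B, (g y).1 = y := fun y hy => by simp [g, hy]
    refine hcol (c, i) (g '' B) (Set.subset_univ _) ?_ ⟨?_, hB.image g fun y hy z hz => ?_⟩
    · rintro _ ⟨y, hy, rfl⟩
      have := (dif_pos (hBY y hy)).symm.trans (hA.1 hy).2
      simp only [Option.some.injEq, Prod.mk.injEq, Fin.ext_iff] at this
      have hgy : g y = ⟨y, hBY y hy⟩ := Subtype.ext (hg y hy)
      rw [hgy]
      exact Prod.ext this.1 this.2
    · rintro _ ⟨y, hy, rfl⟩ _ ⟨z, hz, rfl⟩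
      refine (hLR _ _).2 ?_
      rw [hg y hy]
      refine (before_true.1 (hBx y hy x rfl)).1.trans_le (hmax _ x ⟨hA.2.1, ?_⟩)
      rw [hg z hz]
      exact (before_true.1 (hBx z hz x rfl)).2
    · simp only [p', v', hg y hy, hg z hz]
      exact ⟨id, id⟩

/-! ### The induction -/

/-- For a sum or skew sum `t`, the class of the permutations that avoid `t` is splittable over the
classes of the permutations that avoid a slim pattern of `t` with the same root sign. -/
theorem splits_node : ∀ (n : ℕ) (s : Bool) (a b : SepTree), (node s a b).size = n →
    Splits s (node s a b) := by
  intro n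
  induction n using Nat.strong_induction_on with
  | _ n ih =>
  -- exchanging sums and skew sums, the root may be taken to be a sum
  suffices h : ∀ a b : SepTree, (node true a b).size = n → Splits true (node true a b) by
    rintro (_ | _) a b hn
    · have := (h a.flip b.flip (by simpa [size, size_flip] using hn)).flip
      simpa [flip, flip_flip] using this
    · exact h a b hn
  have hleaf : ∀ a : SepTree, (node true a leaf).size = n → Splits true (node true a leaf) := by
    rintro (_ | ⟨_ | _, a₁, a₂⟩) hn
    · exact (Slim.pair true).splits
    · exact (ih _ (by simp only [size] at hn ⊢; omega) false a₁ a₂ rfl).node_leaf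
    · have h1 := a₁.size_pos
      have h2 := a₂.size_pos
      refine (splitsOver_three a₁ a₂ leaf).splits fun i => ?_
      cases i
      · exact ih _ (by simp only [size] at hn ⊢; omega) true a₂ leaf rfl
      · exact ih _ (by simp only [size] at hn ⊢; omega) true a₁ a₂ rfl
  intro a b hn
  rcases b with _ | ⟨s, b₁, b₂⟩
  · exact hleaf a hn
  rcases a with _ | ⟨s', a₁, a₂⟩
  · have := (hleaf (node s b₁ b₂).rev (by simp only [size, size_rev] at hn ⊢; omega)).rev
    simpa [rev, rev_rev] using this
  · have h1 := a₁.size_pos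
    have h2 := a₂.size_pos
    have h3 := b₁.size_pos
    have h4 := b₂.size_pos
    refine (splitsOver_two (node s' a₁ a₂) (node s b₁ b₂)).splits fun i => ?_
    cases i
    · exact ih _ (by simp only [size] at hn ⊢; omega) true leaf _ rfl
    · exact ih _ (by simp only [size] at hn ⊢; omega) true _ leaf rfl

end SepTree

/-! ### From colourings to merges -/

namespace FinPerm

/-- Every set of elements has a pattern, obtained by standardizing positions and values. -/
theorem exists_isPatternOf (π : FinPerm) (S : Set (Fin π.size)) : ∃ σ, IsPatternOf σ π S := by
  classical
  let A : Finset (Fin π.size) := Finset.univ.filter (· ∈ S)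
  let B : Finset (Fin π.size) := A.map π.perm.toEmbedding
  let f : Fin A.card ≃o A := A.orderIsoOfFin rfl
  let g : Fin A.card ≃o B := B.orderIsoOfFin (Finset.card_map _)
  let e : A ≃ B := π.perm.subtypeEquiv fun x => by simp [B]
  refine ⟨⟨A.card, f.toEquiv.trans (e.trans g.symm.toEquiv)⟩,
    f.toOrderEmbedding.trans (OrderEmbedding.subtype _), ?_, fun i j => ?_⟩
  · ext x
    constructor
    · rintro ⟨i, rfl⟩
      exact (Finset.mem_filter.1 (f i).2).2
    · intro hx
      exact ⟨f.symm ⟨x, by simpa [A] using hx⟩, by simp⟩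
  · exact g.symm.lt_iff_lt (x := e (f i)) (y := e (f j))

end FinPerm

namespace PermClass

/-- A colouring whose classes have patterns in the classes of `L` exhibits a merge. -/
theorem mem_mergeSeq_of_colouring : ∀ (L : List PermClass) (π : FinPerm) (c : Fin π.size → ℕ),
    (∀ x, c x < L.length) →
    (∀ (i : ℕ) (hi : i < L.length) (σ : FinPerm), σ.IsPatternOf π {x | c x = i} → σ ∈ L[i]) →
    π ∈ mergeSeq L
  | [], π, c, hc, _ => by
    have h0 : π.size = 0 := by
      by_contra h
      exact absurd (hc ⟨0, Nat.pos_of_ne_zero h⟩) (Nat.not_lt_zero _)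
    obtain ⟨n, e⟩ := π
    obtain rfl : n = 0 := h0
    exact congrArg (FinPerm.mk 0) (Subsingleton.elim _ _)
  | C :: L, π, c, hc, h => by
    obtain ⟨σ, hσ⟩ := π.exists_isPatternOf {x | c x = 0}
    obtain ⟨τ, g, hg, hgv⟩ := π.exists_isPatternOf {x | c x = 0}ᶜ
    have hg0 : ∀ x, c (g x) ≠ 0 := fun x => by
      have : g x ∈ Set.range g := ⟨x, rfl⟩
      rw [hg] at this
      exact this
    refine ⟨σ, h 0 (by simp) σ hσ, τ, ?_, _, hσ, g, hg, hgv⟩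
    refine mem_mergeSeq_of_colouring L τ (fun x => c (g x) - 1) (fun x => ?_) fun i hi ρ hρ => ?_
    · have h1 := hc (g x)
      have h2 := hg0 x
      simp only [List.length_cons] at h1
      omega
    · obtain ⟨f, hf, hfv⟩ := hρ
      refine h (i + 1) (by simpa using hi) ρ
        ⟨f.trans g, ?_, fun x y => (hfv x y).trans (hgv _ _)⟩
      ext y
      constructor
      · rintro ⟨x, rfl⟩
        have h1 : f x ∈ Set.range f := ⟨x, rfl⟩
        rw [hf] at h1
        have h2 := hg0 (f x)
        replace h1 : c (g (f x)) - 1 = i := h1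
        change c (g (f x)) = i + 1
        omega
      · intro (hy : c y = i + 1)
        have h1 : y ∈ Set.range g := by
          rw [hg]
          simp [hy]
        obtain ⟨z, rfl⟩ := h1
        have h2 : z ∈ Set.range f := by
          rw [hf]
          simp [hy]
        obtain ⟨x, rfl⟩ := h2
        exact ⟨x, rfl⟩

end PermClass

theorem mainTheorem9 (π : FinPerm) (hsep : π.IsSeparable) (hdec : π.IsSumDecomposable) :
    (PermClass.Av {π}).IsSplittableOver
      {C : PermClass | ∃ σ : FinPerm,
        σ ≤ π ∧ σ.IsSlim ∧ σ.IsSumDecomposable ∧ C = PermClass.Av {σ}} := by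
  obtain ⟨t, ht⟩ : ∃ t, π.HasTree t := by
    refine hsep.exists_hasTree.resolve_left fun h => ?_
    obtain ⟨α, β, hα, -, rfl⟩ := hdec
    have : α.size + β.size = 0 := h
    omega
  obtain ⟨a, b, rfl⟩ := ht.exists_sum hdec
  obtain ⟨ι, hι, f, hf, hle, hs⟩ := SepTree.splits_node _ true a b rfl
  obtain ⟨n, ⟨e⟩⟩ := Finite.exists_equiv_fin ι
  refine ⟨List.ofFn fun i => PermClass.Av {(f (e.symm i)).eval}, ?_, fun ρ hρ => ?_⟩
  · intro D hD
    obtain ⟨i, rfl⟩ := List.mem_ofFn.1 hD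
    have hslim := hf (e.symm i)
    refine ⟨_, (FinPerm.le_iff_contains (SepTree.hasTree_eval _)).2
      (hle _ _ _ _ _ ⟨Set.univ, subset_rfl, ht⟩), hslim.isSlim_eval, ?_, rfl⟩
    obtain ⟨c, d, hcd⟩ := hslim.exists_node
    rw [hcd]
    exact SepTree.isSumDecomposable_eval c d
  · obtain ⟨c, hc⟩ := hs _ ρ.pos ρ.val ρ.pos_injective ρ.val_injective Set.univ fun h =>
      hρ π rfl ((FinPerm.le_iff_contains ht).2 h)
    refine PermClass.mem_mergeSeq_of_colouring _ ρ (fun x => e (c x)) (fun x => by simp) ?_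
    rintro i hi σ ⟨g, hg, hgv⟩
    rw [List.getElem_ofFn]
    rintro _ rfl hσ
    obtain ⟨A, -, hA⟩ := (FinPerm.le_iff_contains (SepTree.hasTree_eval _)).1 hσ
    refine hc _ ⟨g '' A, ?_, hA.image g fun x _ y _ => ⟨?_, ?_⟩⟩
    · rintro _ ⟨x, -, rfl⟩
      have : g x ∈ Set.range g := ⟨x, rfl⟩
      rw [hg] at this
      refine ⟨trivial, e.injective (Fin.ext ?_)⟩
      simpa using this
    · rw [FinPerm.pos_lt, FinPerm.pos_lt]; exact g.lt_iff_lt.2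
    · rw [FinPerm.val_lt, FinPerm.val_lt]; exact (hgv x y).1
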